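/- Let $k\ge 2$ be an integer and set $m=k-1$. For $\Re\lambda>0$ let $$Z_k(\lambda)=\int_{-\infty}^{\infty}\frac{d\phi}{\sqrt{2\pi}}\,e^{-\phi^2/2}\,e^{-\lambda\phi^{2k}/2},\qquad Z^c_k(\lambda)=\int_{\mathbb C}\frac{d(\Re\phi)\,d(\Im\phi)}{\pi}\,e^{-\bar\phi\phi}\,e^{-\lambda(\bar\phi\phi)^k},$$ with perturbative coefficients $$a_{k,n}=\frac{(-1)^n}{2^n n!}\prod_{j=1}^{kn}(2j-1),\qquad a^c_{k,n}=(-1)^n\frac{(kn)!}{n!}.$$ Let $\mathcal L=\{(z,\theta)\in\mathbb C^\star\times\mathbb R:\theta\text{ is an argument of }z\}$ be the Riemann surface of the logarithm, with $\log\lambda=\log|z|+i\theta$ and $\lambda^{s}=e^{s\log\lambda}$ for $\lambda=(z,\theta)\in\mathcal L$, and for $\rho>0$ let $$D^m_\rho=\{\lambda=(z,\theta)\in\mathcal L:\ |\theta|<m\pi/2,\ \Re\,\lambda^{-1/m}>\rho^{-1}\}.$$ Then $Z_k$ and $Z^c_k$, regarded as functions on the part $|\theta|<\pi/2$ of $\mathcal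 L$, are Borel–Leroy summable of order $m=k-1$. That is, for $(f,(a_n))$ equal to $(Z_k,(a_{k,n}))$ or to $(Z^c_k,(a^c_{k,n}))$, there are constants $\rho,A,B>0$ (which may depend on $k$) such that: 1. $f$ extends analytically to $D^m_\rho$. 2. For all $N\ge 0$ and all $\lambda\in D^m_\rho$, $$f(\lambda)=\sum_{n<N}a_n\lambda^n+R^Nf(\lambda),\qquad |R^Nf(\lambda)|\le A\,B^N\,(mN)!\,|\lambda|^N,$$ where $R^0f=f$ and, for $N\ge1$, $R^Nf(\lambda)=\lambda^N\int_0^1\frac{(1-t)^{N-1}}{(N-1)!}f^{(N)}(t\lambda)\,dt$, the integral being absolutely convergent. 3. The Borel–Leroy transform $\mathcal B(u)=\sum_{n\ge0}\frac{a_n}{(mn)!}u^n$ converges for $|u|<B^{-1}$. For some $R>0$ it continues analytically to the union of this disk and the strip $\{u:|\Im u|<R,\ \Re u>0\}$, and there $|\mathcal B(u)|\le K\exp(|u|^{1/m}/\rho)$ on the strip for some constant $K$. For every $\lambda\in D^m_\rho$, $$f(\lambda)=\frac1{m\lambda}\int_0^\infty \mathcal B(u)\,e^{-(u/\lambda)^{1/m}}\Bigl(\frac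 u\lambda\Bigr)^{\frac1m-1}du ,$$ the integral being absolutely convergent. -/

import Mathlib

/-- The Riemann surface of the logarithm, embedded in `ℂ × ℝ`: a point is a nonzero complex number
`val` together with a real number `arg` which is one of its arguments. -/
@[ext] structure LogSurface where
  val : ℂ
  arg : ℝ
  val_ne_zero : val ≠ 0
  val_eq : val = (‖val‖ : ℂ) * Complex.exp ((arg : ℂ) * Complex.I)

namespace LogSurface

/-- The single-valued logarithm `log |z| + i θ`. -/
noncomputable def log (p : LogSurface) : ℂ :=
  (Real.log ‖p.val‖ : ℂ) + (p.arg : ℂ) * Complex.I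

/-- The point of the surface with a given logarithm. -/
noncomputable def ofLog (w : ℂ) : LogSurface where
  val := Complex.exp w
  arg := w.im
  val_ne_zero := Complex.exp_ne_zero w
  val_eq := by
    rw [Complex.norm_exp, Complex.ofReal_exp, ← Complex.exp_add, Complex.re_add_im]

/-- The logarithm is a global (biholomorphic) chart of the surface, with values in all of `ℂ`. -/
noncomputable def logEquiv : LogSurface ≃ ℂ where
  toFun := log
  invFun := ofLog
  left_inv p := by
    have h : 0 < ‖p.val‖ := norm_pos_iff.mpr p.val_ne_zero
    have h1 : Complex.exp p.log = p.val := by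
      rw [log, Complex.exp_add, ← Complex.ofReal_exp, Real.exp_log h]
      exact p.val_eq.symm
    have h2 : p.log.im = p.arg := by simp [log]
    exact LogSurface.ext h1 h2
  right_inv w := by
    apply Complex.ext <;> simp [log, ofLog, Complex.norm_exp]

/-- Powers `p ^ s = exp (s log p)`, single-valued on the surface. -/
noncomputable def cpow (p : LogSurface) (s : ℂ) : ℂ := Complex.exp (s * p.log)

/-- The point `t p` on the same sheet and ray as `p`, for `t > 0`. -/
noncomputable def scale (t : ℝ) (p : LogSurface) : LogSurface :=
  ofLog ((Real.log t : ℂ) + p.log)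

/-- The power `(u / p) ^ s = exp (s (log u - log p))`, for a real number `u > 0`. -/
noncomputable def divPow (u : ℝ) (p : LogSurface) (s : ℂ) : ℂ :=
  Complex.exp (s * ((Real.log u : ℂ) - p.log))

/-- Analyticity on a set of points of the surface, in the logarithmic chart. -/
def AnalyticOnSurface (f : LogSurface → ℂ) (D : Set LogSurface) : Prop :=
  AnalyticOnNhd ℂ (fun w => f (ofLog w)) (log '' D)

/-- The derivative `df/dp`: in the chart `p = exp w` it is `exp (-w) d/dw`. -/
noncomputable def sderiv (f : LogSurface → ℂ) : LogSurface → ℂ :=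
  fun p => (p.val)⁻¹ * deriv (fun w => f (ofLog w)) p.log

/-- The `N`-th derivative with respect to the point of the surface. -/
noncomputable def iterSderiv (N : ℕ) (f : LogSurface → ℂ) : LogSurface → ℂ :=
  sderiv^[N] f

/-- The domain `Re p ^ (-1/k) > 1/ρ` (the component of it around the positive real axis,
where `|arg p| < k π / 2`); equivalently `|p| ^ (1/k) < ρ cos (arg p / k)` and
`|arg p| < k π / 2`. -/
def domain (k : ℕ) (ρ : ℝ) : Set LogSurface :=
  {p | |p.arg| < k * Real.pi / 2 ∧ ρ⁻¹ < (p.cpow (-(1 / (k : ℂ)))).re}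

/-- The integrand of the Taylor remainder of order `N + 1`, without the prefactor. -/
noncomputable def remainderIntegrand (N : ℕ) (f : LogSurface → ℂ) (p : LogSurface) (t : ℝ) : ℂ :=
  (((1 - t) ^ N / (N.factorial : ℝ) : ℝ) : ℂ) * iterSderiv (N + 1) f (scale t p)

/-- The Taylor remainder operator `R^N` at the origin, in integral form; `R^0 f = f`. -/
noncomputable def taylorRemainder : ℕ → (LogSurface → ℂ) → LogSurface → ℂ
  | 0, f, p => f p
  | N + 1, f, p => p.val ^ (N + 1) * ∫ t in (0 : ℝ)..1, remainderIntegrand N f p t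

end LogSurface

/-- The Nevanlinna-Sokal conditions of order `k` for a function `f` on the surface of the logarithm
and a formal power series `∑ a n λ^n`, with constants `ρ`, `A`, `B`. -/
structure NevanlinnaSokal (k : ℕ) (a : ℕ → ℂ) (f : LogSurface → ℂ) (ρ A B : ℝ) : Prop where
  analytic : LogSurface.AnalyticOnSurface f (LogSurface.domain k ρ)
  integrable : ∀ N : ℕ, ∀ p ∈ LogSurface.domain k ρ,
    IntervalIntegrable (LogSurface.remainderIntegrand N f p) MeasureTheory.volume 0 1
  expansion : ∀ N : ℕ, ∀ p ∈ LogSurface.domain k ρ,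
    f p = (∑ n ∈ Finset.range N, a n * p.val ^ n) + LogSurface.taylorRemainder N f p
  bound : ∀ N : ℕ, ∀ p ∈ LogSurface.domain k ρ,
    ‖LogSurface.taylorRemainder N f p‖ ≤ A * B ^ N * ((k * N).factorial : ℝ) * ‖p.val‖ ^ N

/-- `f` is recovered on the domain from the Borel-Leroy transform of order `k` of `∑ a n λ^n`: `T` is
the sum of the transformed series on `|u| < 1/B`, continued analytically to a strip of half-width
`R` around the positive real axis, with the growth that the inverse integral allows. -/
structure BorelLeroyInversion (k : ℕ) (a : ℕ → ℂ) (f : LogSurface → ℂ) (ρ B : ℝ)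
    (T : ℂ → ℂ) (R K : ℝ) : Prop where
  transform : ∀ u : ℂ, ‖u‖ < B⁻¹ →
    HasSum (fun n : ℕ => a n / ((k * n).factorial : ℂ) * u ^ n) (T u)
  continuation : AnalyticOnNhd ℂ T
    (Metric.ball 0 B⁻¹ ∪ {u : ℂ | |u.im| < R ∧ 0 < u.re})
  growth : ∀ u : ℂ, |u.im| < R → 0 < u.re →
    ‖T u‖ ≤ K * Real.exp (‖u‖ ^ (1 / (k : ℝ)) / ρ)
  integrable : ∀ p ∈ LogSurface.domain k ρ,
    MeasureTheory.IntegrableOn (fun u : ℝ => T u *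
      Complex.exp (-LogSurface.divPow u p (1 / (k : ℂ))) *
        LogSurface.divPow u p (1 / (k : ℂ) - 1)) (Set.Ioi 0)
  inverse : ∀ p ∈ LogSurface.domain k ρ,
    f p = 1 / ((k : ℂ) * p.val) * ∫ u in Set.Ioi (0 : ℝ), T u *
      Complex.exp (-LogSurface.divPow u p (1 / (k : ℂ))) *
        LogSurface.divPow u p (1 / (k : ℂ) - 1)

/-- The power series `∑ a n λ^n` is Borel-Leroy summable of order `k` to `f`: the Nevanlinna-Sokal
conditions of order `k` hold, and `f` is the Borel-Leroy sum of the series. -/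
def BorelLeroySummable (k : ℕ) (a : ℕ → ℂ) (f : LogSurface → ℂ) : Prop :=
  ∃ ρ A B : ℝ, 0 < ρ ∧ 0 < A ∧ 0 < B ∧ NevanlinnaSokal k a f ρ A B ∧
    ∃ (T : ℂ → ℂ) (R K : ℝ), 0 < R ∧ BorelLeroyInversion k a f ρ B T R K

/-- `f` coincides with `Z` over the right half-plane of the principal sheet. -/
def ExtendsHalfPlane (Z : ℂ → ℂ) (f : LogSurface → ℂ) : Prop :=
  ∀ p : LogSurface, |p.arg| < Real.pi / 2 → f p = Z p.val

/-- The partition function `∫ dμ(φ) exp (-z φ^(2k) / 2)`, `μ` the standard Gaussian measure. -/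
noncomputable def partitionZ (k : ℕ) (z : ℂ) : ℂ :=
  ∫ φ : ℝ, Complex.exp (-z * (φ : ℂ) ^ (2 * k) / 2) ∂(ProbabilityTheory.gaussianReal 0 1)

/-- The partition function `∫ dμᶜ(φ) exp (-z (φ̄ φ)^k)`, where
`dμᶜ(φ) = π⁻¹ exp (-φ̄ φ) d(Re φ) d(Im φ)` is the normalized complex Gaussian measure. -/
noncomputable def partitionZc (k : ℕ) (z : ℂ) : ℂ :=
  ∫ φ : ℂ, (Real.pi : ℂ)⁻¹ * Complex.exp (-(starRingEnd ℂ φ * φ)) *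
    Complex.exp (-z * (starRingEnd ℂ φ * φ) ^ k)

/-- The perturbative coefficients `(-1)^n (2kn - 1)!! / (2^n n!)` of the real model. -/
noncomputable def coeffZ (k n : ℕ) : ℂ :=
  (-1) ^ n * (∏ j ∈ Finset.Icc 1 (k * n), (2 * (j : ℂ) - 1)) / (2 ^ n * (n.factorial : ℂ))

/-- The perturbative coefficients `(-1)^n (kn)! / n!` of the complex model. -/
noncomputable def coeffZc (k n : ℕ) : ℂ :=
  (-1) ^ n * ((k * n).factorial : ℂ) / (n.factorial : ℂ)

/-!
Write `m = k - 1`. In both models the partition function is a Laplace transform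
`Z(λ) = ∫ exp (-λ x) dμ(x)` of a probability measure `μ` on `(0, ∞)` (the law of `φ ^ (2k) / 2`, resp.
of `|φ| ^ (2k)`) whose real power moments are `c ^ t Γ(α + k t) / Γ(α)`, with `α = 1/2, c = 2 ^ m`
in the real model and `α = 1, c = 1` in the complex one.

The Borel-Leroy transform is a Stieltjes function. By the Gauss multiplication formula, the quotient
of the moments by `Γ(1 + t) Γ(1 + m t)` is, up to a factor `M ^ t`, a product of ratios
`Γ(t + a) / Γ(t + b)` with `a ≤ b`, normalized at `t = 0`: these are the moments of Beta laws. So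
there is a probability measure `ν` on `(0, M]` with these moments (`exists_stieltjesMeasure`),
and the transform is `T(u) = ∫ dν(τ) / (1 + u τ)`. It is analytic for `Re u > 0` and near the origin,
it is bounded by `1` for `Re u > 0`, and its Taylor remainder of order `N` is `u ^ N` times a function
bounded by `M ^ N` there. That `Z` really is the Borel sum comes from an identity of laws: `μ` is
the law of `p s ^ m τ` with `p`, `s` exponential and `τ` of law `ν`, all independent, because a law
on `(0, ∞)` is determined by its power moments near `0` (`ext_of_powMoment`). Integrating out `p`
gives `Z(λ) = ∫ exp (-s) T(λ s ^ m) ds` for `λ > 0`.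

The Borel sum is `∫ z exp (-z s) T(λ z ^ m s ^ m) ds` along any ray `z` with `Re z > 0` and
`Re (λ z ^ m) > 0`. In the variable `log z` this integral is holomorphic and invariant under real
translations, hence constant (`rayLaplace_congr_ray`). The choice `λ z ^ m = 1` gives the inversion
formula and analyticity on `|arg λ| < m π / 2`, the choice `z = 1` gives the equality with `Z`, and
a ray along which `arg z` stays away from `± π / 2` gives remainder bounds
uniform in `arg λ` (`norm_borelSum_sub_le`). Finally, a function with an asymptotic expansion to all
orders in a strip of the logarithmic chart has, by Cauchy's estimate, derivatives with the
differentiated expansions, so that Taylor's formula holds with base point `0`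
(`LogSurface.taylor_of_hasStripExpansion`) and the remainder just bounded is its integral
remainder.
-/

open MeasureTheory ProbabilityTheory Set Filter Topology

/-! ### The Gauss multiplication formula for positive arguments -/

theorem Real.convexOn_log_Gamma_comp_add_div {k : ℝ} (hk : 0 < k) {a : ℝ} (ha : 0 ≤ a) :
    ConvexOn ℝ (Ioi (0 : ℝ)) (fun x => Real.log (Real.Gamma ((x + a) / k))) := by
  have h := Real.convexOn_log_Gamma
  refine ⟨convex_Ioi 0, fun x hx y hy s t hs ht hst => ?_⟩
  have hx' : (x + a) / k ∈ Ioi (0 : ℝ) := div_pos (add_pos_of_pos_of_nonneg hx ha) hk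
  have hy' : (y + a) / k ∈ Ioi (0 : ℝ) := div_pos (add_pos_of_pos_of_nonneg hy ha) hk
  have := h.2 hx' hy' hs ht hst
  simp only [smul_eq_mul, Function.comp_apply] at this ⊢
  have e : (s * x + t * y + a) / k = s * ((x + a) / k) + t * ((y + a) / k) := by
    have : a = (s + t) * a := by rw [hst, one_mul]
    field_simp
    linear_combination this
  rw [e]
  exact this

/-- The Gauss multiplication formula with an unspecified constant. It follows from the Bohr-Mollerup
theorem, and the constant cancels in the ratios to which the formula is applied. -/
theorem Real.prod_Gamma_add_div {k : ℕ} (hk : 0 < k) :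
    ∃ C : ℝ, 0 < C ∧ ∀ x : ℝ, 0 < x →
      ∏ i ∈ Finset.range k, Real.Gamma ((x + i) / k) = C * (k : ℝ) ^ (-x) * Real.Gamma x := by
  have hk' : (0 : ℝ) < k := Nat.cast_pos.mpr hk
  have hG : ∀ x : ℝ, 0 < x → ∀ i : ℕ, 0 < Real.Gamma ((x + i) / k) := fun x hx i =>
    Real.Gamma_pos_of_pos (div_pos (by positivity) hk')
  have hP : ∀ x : ℝ, 0 < x → 0 < ∏ i ∈ Finset.range k, Real.Gamma ((x + i) / k) :=
    fun x hx => Finset.prod_pos fun i _ => hG x hx i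
  set Q := ∏ i ∈ Finset.range k, Real.Gamma ((1 + i) / k) with hQ
  have hQ0 : 0 < Q := hP 1 one_pos
  set g : ℝ → ℝ := fun x =>
    (k : ℝ) ^ (x - 1) * (∏ i ∈ Finset.range k, Real.Gamma ((x + i) / k)) / Q with hg
  have key : EqOn g Real.Gamma (Ioi 0) := by
    apply Real.eq_Gamma_of_log_convex
    · have h1 : ConvexOn ℝ (Ioi (0 : ℝ)) (fun x : ℝ =>
          ∑ i ∈ Finset.range k, Real.log (Real.Gamma ((x + i) / k))) := by
        have : ∀ s : Finset ℕ, ConvexOn ℝ (Ioi (0 : ℝ)) (fun x : ℝ =>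
          ∑ i ∈ s, Real.log (Real.Gamma ((x + i) / k))) := by
          intro s
          induction s using Finset.induction_on with
          | empty => simpa using convexOn_const (0 : ℝ) (convex_Ioi (0 : ℝ))
          | insert a s ha ih =>
            simp only [Finset.sum_insert ha]
            exact (Real.convexOn_log_Gamma_comp_add_div hk' (Nat.cast_nonneg a)).add ih
        exact this _
      have h2 : ConvexOn ℝ (Ioi (0 : ℝ)) (fun x : ℝ => Real.log k * x) :=
        (convexOn_id (convex_Ioi (0 : ℝ))).smul (Real.log_nonneg (by exact_mod_cast hk))
      refine ((h2.add h1).add_const (-Real.log k - Real.log Q)).congr fun x hx => ?_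
      have hx : 0 < x := hx
      simp only [Function.comp_apply, hg, Pi.add_apply]
      rw [Real.log_div (mul_pos (Real.rpow_pos_of_pos hk' _) (hP x hx)).ne' hQ0.ne',
        Real.log_mul (Real.rpow_pos_of_pos hk' _).ne' (hP x hx).ne', Real.log_rpow hk',
        Real.log_prod fun i _ => (hG x hx i).ne']
      ring
    · intro y hy
      obtain ⟨n, rfl⟩ : ∃ n, k = n + 1 := ⟨k - 1, by omega⟩
      simp only [hg]
      have e : ∏ i ∈ Finset.range (n + 1), Real.Gamma ((y + 1 + i) / (n + 1 : ℕ))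
          = (∏ i ∈ Finset.range n, Real.Gamma ((y + (i + 1 : ℕ)) / (n + 1 : ℕ)))
            * (y / (n + 1 : ℕ) * Real.Gamma (y / (n + 1 : ℕ))) := by
        rw [Finset.prod_range_succ]
        congr 1
        · refine Finset.prod_congr rfl fun i _ => ?_
          congr 2; push_cast; ring
        · rw [← Real.Gamma_add_one (div_pos hy hk').ne']
          congr 1; field_simp; push_cast; ring
      rw [e, Finset.prod_range_succ', show y + 1 - 1 = y - 1 + 1 by ring,
        Real.rpow_add_one hk'.ne']
      simp only [Nat.cast_zero, add_zero]
      field_simp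
    · intro y hy
      exact div_pos (mul_pos (Real.rpow_pos_of_pos hk' _) (hP y hy)) hQ0
    · simp only [hg, sub_self, Real.rpow_zero, one_mul]
      exact div_self hQ0.ne'
  refine ⟨Q * k, by positivity, fun x hx => ?_⟩
  rw [← key hx]
  simp only [hg]
  rw [Real.rpow_sub hk', Real.rpow_one, Real.rpow_neg hk'.le]
  have := (Real.rpow_pos_of_pos hk' x).ne'
  field_simp

/-! ### Power moments of laws on the positive half-line -/

/-- The moment of real order `t` of a measure on `ℝ`, meant for measures carried by `(0, ∞)`; it
takes values in `ℝ≥0∞`, so that no integrability has to be carried along. -/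
noncomputable def powMoment (μ : Measure ℝ) (t : ℝ) : ENNReal :=
  ∫⁻ x, ENNReal.ofReal (x ^ t) ∂μ

theorem measurable_ofReal_rpow (t : ℝ) : Measurable fun x : ℝ => ENNReal.ofReal (x ^ t) := by
  fun_prop

theorem powMoment_dirac_one (t : ℝ) : powMoment (Measure.dirac 1) t = 1 := by
  simp [powMoment, lintegral_dirac]

theorem measurable_betaPDF (a b : ℝ) : Measurable (betaPDF a b) :=
  (measurable_betaPDFReal a b).ennreal_ofReal

theorem measurable_gammaPDF (a r : ℝ) : Measurable (gammaPDF a r) :=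
  (measurable_gammaPDFReal a r).ennreal_ofReal

theorem powMoment_betaMeasure {a b : ℝ} (ha : 0 < a) (hb : 0 < b) {t : ℝ} (ht : 0 < a + t) :
    powMoment (betaMeasure a b) t = ENNReal.ofReal (beta (a + t) b / beta a b) := by
  have hq : 0 < beta (a + t) b / beta a b := div_pos (beta_pos ht hb) (beta_pos ha hb)
  have e : ∀ x : ℝ, (betaPDF a b x) * ENNReal.ofReal (x ^ t)
      = ENNReal.ofReal (beta (a + t) b / beta a b) * betaPDF (a + t) b x := by
    intro x
    rw [betaPDF, betaPDF, mul_comm]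
    by_cases hx : 0 < x ∧ x < 1
    · rw [← ENNReal.ofReal_mul (Real.rpow_nonneg hx.1.le _), ← ENNReal.ofReal_mul hq.le]
      congr 1
      simp only [betaPDFReal, if_pos hx]
      rw [show a + t - 1 = t + (a - 1) by ring, Real.rpow_add hx.1]
      have := (beta_pos ha hb).ne'
      have := (beta_pos ht hb).ne'
      field_simp
    · simp [betaPDFReal, if_neg hx]
  rw [powMoment, betaMeasure, lintegral_withDensity_eq_lintegral_mul _
    (measurable_betaPDF a b) (measurable_ofReal_rpow t)]
  simp only [Pi.mul_apply, e]
  rw [lintegral_const_mul _ (measurable_betaPDF _ b),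
    lintegral_betaPDF_eq_one ht hb, mul_one]

theorem powMoment_gammaMeasure {a : ℝ} (ha : 0 < a) {t : ℝ} (ht : 0 < a + t) :
    powMoment (gammaMeasure a 1) t = ENNReal.ofReal (Real.Gamma (a + t) / Real.Gamma a) := by
  have hA := Real.Gamma_pos_of_pos ha
  have hT := Real.Gamma_pos_of_pos ht
  have e : ∀ᵐ x : ℝ, (gammaPDF a 1 x) * ENNReal.ofReal (x ^ t)
      = ENNReal.ofReal (Real.Gamma (a + t) / Real.Gamma a) * gammaPDF (a + t) 1 x := by
    filter_upwards [Measure.ae_ne volume (0 : ℝ)] with x hx0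
    rw [gammaPDF, gammaPDF, mul_comm]
    by_cases hx : 0 ≤ x
    · have hx0 : 0 < x := lt_of_le_of_ne hx (Ne.symm hx0)
      rw [← ENNReal.ofReal_mul (Real.rpow_nonneg hx _), ← ENNReal.ofReal_mul (div_pos hT hA).le]
      congr 1
      simp only [gammaPDFReal, if_pos hx]
      rw [show a + t - 1 = t + (a - 1) by ring, Real.rpow_add hx0]
      simp only [Real.one_rpow]
      field_simp
    · simp [gammaPDFReal, if_neg hx]
  rw [powMoment, gammaMeasure, lintegral_withDensity_eq_lintegral_mul _
    (measurable_gammaPDF a 1) (measurable_ofReal_rpow t)]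
  simp only [Pi.mul_apply]
  rw [lintegral_congr_ae e, lintegral_const_mul _ (measurable_gammaPDF _ 1),
    lintegral_gammaPDF_eq_one ht one_pos, mul_one]

theorem ae_pos_gammaMeasure (a : ℝ) : ∀ᵐ x ∂(gammaMeasure a 1), 0 < x := by
  rw [gammaMeasure, ae_withDensity_iff (measurable_gammaPDF a 1)]
  filter_upwards [Measure.ae_ne volume (0 : ℝ)] with x hx0 hx
  by_contra h
  exact hx (gammaPDF_of_neg (lt_of_le_of_ne (not_lt.mp h) hx0))

theorem ae_mem_Ioc_betaMeasure (a b : ℝ) : ∀ᵐ x ∂(betaMeasure a b), 0 < x ∧ x ≤ 1 := by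
  rw [betaMeasure, ae_withDensity_iff (measurable_betaPDF a b)]
  refine Eventually.of_forall fun x hx => ?_
  by_contra h
  rcases not_and_or.mp h with h | h
  · exact hx (betaPDF_eq_zero_of_nonpos (not_lt.mp h))
  · exact hx (betaPDF_eq_zero_of_one_le (not_le.mp h).le)

/-- The law of the product of two independent real random variables with given laws. -/
noncomputable def mulLaw (μ ν : Measure ℝ) : Measure ℝ := (μ.prod ν).map (fun p => p.1 * p.2)

instance (μ ν : Measure ℝ) [IsProbabilityMeasure μ] [IsProbabilityMeasure ν] :
    IsProbabilityMeasure (mulLaw μ ν) :=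
  Measure.isProbabilityMeasure_map (by fun_prop)

theorem ae_mulLaw {μ ν : Measure ℝ} [SFinite μ] [SFinite ν] {p q r : ℝ → Prop}
    (hp : ∀ᵐ x ∂μ, p x) (hq : ∀ᵐ x ∂ν, q x) (hr : MeasurableSet {x | r x})
    (h : ∀ x y, p x → q y → r (x * y)) : ∀ᵐ x ∂(mulLaw μ ν), r x := by
  rw [mulLaw, ae_map_iff (by fun_prop) hr]
  filter_upwards [Measure.quasiMeasurePreserving_fst.ae hp,
    Measure.quasiMeasurePreserving_snd.ae hq] with z h1 h2 using h _ _ h1 h2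

theorem powMoment_mulLaw {μ ν : Measure ℝ} [SFinite μ] [SFinite ν]
    (hμ : ∀ᵐ x ∂μ, 0 < x) (t : ℝ) (hν : ∀ᵐ x ∂ν, 0 < x) :
    powMoment (mulLaw μ ν) t = powMoment μ t * powMoment ν t := by
  rw [powMoment, mulLaw, lintegral_map (measurable_ofReal_rpow t) (by fun_prop), powMoment,
    powMoment, ← lintegral_prod_mul (measurable_ofReal_rpow t).aemeasurable
      (measurable_ofReal_rpow t).aemeasurable]
  refine lintegral_congr_ae ?_
  filter_upwards [Measure.quasiMeasurePreserving_fst.ae hμ,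
    Measure.quasiMeasurePreserving_snd.ae hν] with z h1 h2
  rw [Real.mul_rpow h1.le h2.le, ENNReal.ofReal_mul (Real.rpow_nonneg h1.le _)]

theorem powMoment_map_rpow {μ : Measure ℝ} (hμ : ∀ᵐ x ∂μ, 0 < x) (p t : ℝ) :
    powMoment (μ.map fun x => x ^ p) t = powMoment μ (p * t) := by
  rw [powMoment, lintegral_map (measurable_ofReal_rpow t) (by fun_prop), powMoment]
  refine lintegral_congr_ae ?_
  filter_upwards [hμ] with x hx
  rw [Real.rpow_mul hx.le]

theorem integrable_rpow_of_powMoment {μ : Measure ℝ} (hμ : ∀ᵐ x ∂μ, 0 < x) {t v : ℝ}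
    (h : powMoment μ t = ENNReal.ofReal v) : Integrable (fun x => x ^ t) μ := by
  refine ⟨by fun_prop, ?_⟩
  rw [hasFiniteIntegral_iff_ofReal (hμ.mono fun x hx => Real.rpow_nonneg hx.le _)]
  exact h.trans_lt ENNReal.ofReal_lt_top

theorem integral_rpow_of_powMoment {μ : Measure ℝ} (hμ : ∀ᵐ x ∂μ, 0 < x) {t v : ℝ} (hv : 0 ≤ v)
    (h : powMoment μ t = ENNReal.ofReal v) : ∫ x, x ^ t ∂μ = v := by
  rw [integral_eq_lintegral_of_nonneg_ae (hμ.mono fun x hx => Real.rpow_nonneg hx.le _)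
    (by fun_prop)]
  exact (congrArg ENNReal.toReal h).trans (ENNReal.toReal_ofReal hv)

theorem frequently_nhdsNE_of_forall_ofReal {P : ℂ → Prop} (h : ∀ᶠ t : ℝ in 𝓝 0, P t) :
    ∃ᶠ z in 𝓝[≠] (0 : ℂ), P z := by
  have h1 : Tendsto (fun t : ℝ => (t : ℂ)) (𝓝[≠] 0) (𝓝[≠] 0) := by
    refine tendsto_nhdsWithin_of_tendsto_nhds_of_eventually_within _ ?_ ?_
    · have : Tendsto (fun t : ℝ => (t : ℂ)) (𝓝 0) (𝓝 0) := by
        simpa using Complex.continuous_ofReal.tendsto (0 : ℝ)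
      exact this.mono_left nhdsWithin_le_nhds
    · filter_upwards [self_mem_nhdsWithin] with t ht
      simpa using ht
  exact h1.frequently (h.filter_mono nhdsWithin_le_nhds).frequently

/-- A law on `(0, ∞)` is determined by its power moments of order near `0`: these are the moment
generating function of the logarithm, which extends analytically to a vertical strip containing
the imaginary axis, where it is the characteristic function. -/
theorem ext_of_powMoment {μ ν : Measure ℝ} [IsProbabilityMeasure μ] [IsProbabilityMeasure ν]
    (hμ : ∀ᵐ x ∂μ, 0 < x) (hν : ∀ᵐ x ∂ν, 0 < x) {ε : ℝ} (hε : 0 < ε)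
    (hfin : ∀ t, |t| < ε → powMoment μ t ≠ ⊤)
    (h : ∀ t, |t| < ε → powMoment μ t = powMoment ν t) : μ = ν := by
  have hexp : ∀ (ρ : Measure ℝ), (∀ᵐ x ∂ρ, 0 < x) → ∀ t : ℝ,
      (fun x => Real.exp (t * Real.log x)) =ᵐ[ρ] fun x => x ^ t := by
    intro ρ hρ t
    filter_upwards [hρ] with x hx
    rw [Real.rpow_def_of_pos hx, mul_comm]
  have hint : ∀ (ρ : Measure ℝ), (∀ᵐ x ∂ρ, 0 < x) → (∀ t, |t| < ε → powMoment ρ t ≠ ⊤) →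
      ∀ t, |t| < ε → t ∈ interior (integrableExpSet Real.log ρ) := by
    intro ρ hρ hf t ht
    have : Ioo (-ε) ε ⊆ integrableExpSet Real.log ρ := by
      intro s hs
      refine (integrable_congr (hexp ρ hρ s)).mpr ?_
      exact integrable_rpow_of_powMoment hρ (ENNReal.ofReal_toReal (hf s (abs_lt.mpr hs))).symm
    exact interior_maximal this isOpen_Ioo (abs_lt.mp ht)
  have hX : AnalyticOnNhd ℂ (complexMGF Real.log μ) {z | |z.re| < ε} :=
    analyticOnNhd_complexMGF.mono fun z hz => hint μ hμ hfin _ hz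
  have hY : AnalyticOnNhd ℂ (complexMGF Real.log ν) {z | |z.re| < ε} :=
    analyticOnNhd_complexMGF.mono fun z hz => hint ν hν (fun t ht => h t ht ▸ hfin t ht) _ hz
  have hconv : Convex ℝ {z : ℂ | |z.re| < ε} := by
    have : {z : ℂ | |z.re| < ε} = Complex.reLm ⁻¹' Ioo (-ε) ε := by
      ext z; simp [abs_lt]
    rw [this]; exact (convex_Ioo _ _).linear_preimage _
  have hreal : ∀ t : ℝ, |t| < ε → complexMGF Real.log μ t = complexMGF Real.log ν t := by
    intro t ht
    rw [complexMGF_ofReal, complexMGF_ofReal, mgf, mgf, integral_congr_ae (hexp μ hμ t),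
      integral_congr_ae (hexp ν hν t),
      integral_rpow_of_powMoment hμ ENNReal.toReal_nonneg (ENNReal.ofReal_toReal (hfin t ht)).symm,
      integral_rpow_of_powMoment hν ENNReal.toReal_nonneg
        (ENNReal.ofReal_toReal (h t ht ▸ hfin t ht)).symm, h t ht]
  have hfreq : ∃ᶠ z in 𝓝[≠] (0 : ℂ), complexMGF Real.log μ z = complexMGF Real.log ν z := by
    refine frequently_nhdsNE_of_forall_ofReal ?_
    filter_upwards [Metric.ball_mem_nhds (0 : ℝ) hε] with t ht
    exact hreal t (by simpa using ht)
  have hEq := hX.eqOn_of_preconnected_of_frequently_eq hY hconv.isPreconnected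
    (z₀ := 0) (by simpa using hε) hfreq
  have hmap : μ.map Real.log = ν.map Real.log := by
    have : IsProbabilityMeasure (μ.map Real.log) :=
      Measure.isProbabilityMeasure_map Real.measurable_log.aemeasurable
    have : IsProbabilityMeasure (ν.map Real.log) :=
      Measure.isProbabilityMeasure_map Real.measurable_log.aemeasurable
    refine Measure.ext_of_charFun (funext fun t => ?_)
    rw [← complexMGF_mul_I Real.measurable_log.aemeasurable,
      ← complexMGF_mul_I Real.measurable_log.aemeasurable]
    exact hEq (by simpa using hε)
  have hback : ∀ (ρ : Measure ℝ), (∀ᵐ x ∂ρ, 0 < x) → (ρ.map Real.log).map Real.exp = ρ := by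
    intro ρ hρ
    rw [Measure.map_map Real.measurable_exp Real.measurable_log]
    conv_rhs => rw [← Measure.map_id (μ := ρ)]
    refine Measure.map_congr ?_
    filter_upwards [hρ] with x hx
    simp [Real.exp_log hx]
  rw [← hback μ hμ, ← hback ν hν, hmap]

/-! ### The measure representing the Borel-Leroy transform -/

/-- The witness is a Beta law, or the Dirac mass at `1` when `a = b`. -/
theorem exists_powMoment_eq_Gamma_ratio {a b : ℝ} (ha : 0 < a) (hab : a ≤ b) :
    ∃ ν : Measure ℝ, IsProbabilityMeasure ν ∧ (∀ᵐ x ∂ν, 0 < x ∧ x ≤ 1) ∧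
      ∀ t, 0 < a + t → powMoment ν t =
        ENNReal.ofReal (Real.Gamma (a + t) / Real.Gamma (b + t) / (Real.Gamma a / Real.Gamma b)) := by
  rcases hab.eq_or_lt with rfl | hab
  · refine ⟨Measure.dirac 1, inferInstance, ?_, fun t ht => ?_⟩
    · rw [ae_dirac_eq]; simp
    · rw [powMoment_dirac_one, div_self (Real.Gamma_pos_of_pos ht).ne',
        div_self (Real.Gamma_pos_of_pos ha).ne']
      simp
  · have hb : 0 < b - a := sub_pos.mpr hab
    refine ⟨betaMeasure a (b - a), isProbabilityMeasureBeta ha hb, ae_mem_Ioc_betaMeasure _ _,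
      fun t ht => ?_⟩
    rw [powMoment_betaMeasure ha hb ht, beta, beta, show a + t + (b - a) = b + t by ring,
      show a + (b - a) = b by ring]
    congr 1
    have := (Real.Gamma_pos_of_pos hb).ne'
    have := (Real.Gamma_pos_of_pos ha).ne'
    have := (Real.Gamma_pos_of_pos (ha.trans hab)).ne'
    have := (Real.Gamma_pos_of_pos (show 0 < b + t by linarith)).ne'
    field_simp

theorem exists_powMoment_eq_prod_Gamma_ratio {A B : ℕ → ℝ} (n : ℕ) (hA : ∀ i < n, 0 < A i)
    (hAB : ∀ i < n, A i ≤ B i) :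
    ∃ ν : Measure ℝ, IsProbabilityMeasure ν ∧ (∀ᵐ x ∂ν, 0 < x ∧ x ≤ 1) ∧
      ∀ t, (∀ i < n, 0 < A i + t) → powMoment ν t =
        ENNReal.ofReal (∏ i ∈ Finset.range n, Real.Gamma (A i + t) / Real.Gamma (B i + t) /
          (Real.Gamma (A i) / Real.Gamma (B i))) := by
  induction n with
  | zero =>
    refine ⟨Measure.dirac 1, inferInstance, ?_, fun t _ => ?_⟩
    · rw [ae_dirac_eq]; simp
    · simp [powMoment_dirac_one]
  | succ n ih =>
    obtain ⟨ν, hν, hν1, hνt⟩ := ih (fun i hi => hA i (by omega)) (fun i hi => hAB i (by omega))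
    obtain ⟨κ, hκ, hκ1, hκt⟩ := exists_powMoment_eq_Gamma_ratio (hA n (by omega)) (hAB n (by omega))
    refine ⟨mulLaw ν κ, inferInstance, ?_, fun t ht => ?_⟩
    · refine ae_mulLaw hν1 hκ1 measurableSet_Ioc ?_
      rintro x y ⟨hx, hx1⟩ ⟨hy, hy1⟩
      exact ⟨mul_pos hx hy, mul_le_one₀ hx1 hy.le hy1⟩
    · rw [powMoment_mulLaw (hν1.mono fun _ h => h.1) t (hκ1.mono fun _ h => h.1),
        hνt t fun i hi => ht i (by omega), hκt t (ht n (by omega)), Finset.prod_range_succ,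
        ENNReal.ofReal_mul]
      refine Finset.prod_nonneg fun i hi => ?_
      have hi : i < n := Finset.mem_range.mp hi
      have h1 := hA i (by omega)
      have h2 := hAB i (by omega)
      have h3 := ht i (by omega)
      have := Real.Gamma_pos_of_pos h1
      have := Real.Gamma_pos_of_pos (h1.trans_le h2)
      have := Real.Gamma_pos_of_pos h3
      have := Real.Gamma_pos_of_pos (show 0 < B i + t by linarith)
      positivity

/-- The moments `c ^ t Γ(α + (m + 1) t) / (Γ(α) Γ(1 + t) Γ(1 + m t))` are those of a law on a
bounded interval. By the Gauss formula they are, up to `M ^ t`, the normalized product of the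
`Γ(t + A i) / Γ(t + B i)`, where `A` lists `(α + i) / (m + 1)` for `i ≤ m` and `B` lists
`(1 + i) / m` for `i < m` followed by `1`; since `α ≤ 1`, one has `A i ≤ B i` throughout. -/
theorem exists_stieltjesMeasure {m : ℕ} (hm : 1 ≤ m) {α c : ℝ} (hα : 0 < α) (hα1 : α ≤ 1)
    (hc : 0 < c) :
    ∃ (ν : Measure ℝ) (M : ℝ), IsProbabilityMeasure ν ∧ 0 < M ∧ (∀ᵐ x ∂ν, 0 < x ∧ x ≤ M) ∧
      ∀ t, 0 < α + (m + 1) * t → powMoment ν t = ENNReal.ofReal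
        (c ^ t * Real.Gamma (α + (m + 1) * t) / (Real.Gamma α * Real.Gamma (1 + t) *
          Real.Gamma (1 + m * t))) := by
  have hm0 : (0 : ℝ) < m := by exact_mod_cast hm
  have hk0 : (0 : ℝ) < (m + 1 : ℕ) := by positivity
  obtain ⟨C, hC, hCx⟩ := Real.prod_Gamma_add_div (k := m + 1) (by omega)
  obtain ⟨D, hD, hDx⟩ := Real.prod_Gamma_add_div (k := m) (by omega)
  set A : ℕ → ℝ := fun i => (α + i) / (m + 1 : ℕ) with hA
  set B : ℕ → ℝ := fun i => if i < m then (1 + i) / m else 1 with hB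
  have hApos : ∀ i, 0 < A i := fun i => by simp only [hA]; positivity
  have hAB : ∀ i < m + 1, A i ≤ B i := by
    intro i hi
    simp only [hA, hB]
    split_ifs with h
    · rw [div_le_div_iff₀ hk0 hm0]
      have : (0 : ℝ) ≤ i := Nat.cast_nonneg i
      push_cast
      nlinarith
    · rw [div_le_one hk0, show i = m by omega]
      push_cast; linarith
  obtain ⟨ν, hν, hν1, hνt⟩ := exists_powMoment_eq_prod_Gamma_ratio (A := A) (B := B) (m + 1)
    (fun i _ => hApos i) hAB
  set M : ℝ := c * (m + 1 : ℕ) ^ (m + 1) / m ^ m with hM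
  have hM0 : 0 < M := by positivity
  have hdir : ∀ᵐ x ∂(Measure.dirac M), x = M := by rw [ae_dirac_eq]; simp
  refine ⟨mulLaw (Measure.dirac M) ν, M, inferInstance, hM0, ?_, fun t ht => ?_⟩
  · refine ae_mulLaw hdir hν1 measurableSet_Ioc ?_
    rintro x y rfl ⟨hy, hy1⟩
    exact ⟨mul_pos hM0 hy, mul_le_of_le_one_right hM0.le hy1⟩
  rw [powMoment_mulLaw (hdir.mono fun x hx => hx ▸ hM0) t (hν1.mono fun x hx => hx.1), hνt]
  swap
  · intro i _
    have e : A i + t = (α + (m + 1) * t + i) / (m + 1 : ℕ) := by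
      simp only [hA]; field_simp; push_cast; ring
    rw [e]
    exact div_pos (add_pos_of_pos_of_nonneg ht (Nat.cast_nonneg i)) hk0
  have hdM : powMoment (Measure.dirac M) t = ENNReal.ofReal (M ^ t) := by
    rw [powMoment, lintegral_dirac' _ (measurable_ofReal_rpow t)]
  rw [hdM, ← ENNReal.ofReal_mul (Real.rpow_nonneg hM0.le _)]
  congr 1
  have hmt : 0 < 1 + m * t := by
    have : -1 < (m + 1) * t := by linarith
    have h2 : (m + 1) * (m * t) > -m := by nlinarith
    nlinarith
  have numer : ∀ s, 0 < α + (m + 1) * s → ∏ i ∈ Finset.range (m + 1), Real.Gamma (A i + s)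
      = C * ((m + 1 : ℕ) : ℝ) ^ (-(α + (m + 1) * s)) * Real.Gamma (α + (m + 1) * s) := by
    intro s hs
    rw [← hCx _ hs]
    refine Finset.prod_congr rfl fun i _ => ?_
    congr 1
    simp only [hA]; field_simp; push_cast; ring
  have denom : ∀ s : ℝ, 0 < 1 + m * s → ∏ i ∈ Finset.range (m + 1), Real.Gamma (B i + s)
      = D * (m : ℝ) ^ (-(1 + m * s)) * Real.Gamma (1 + m * s) * Real.Gamma (1 + s) := by
    intro s hs
    rw [Finset.prod_range_succ, ← hDx _ hs]
    congr 1
    · refine Finset.prod_congr rfl fun i hi => ?_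
      congr 1
      simp only [hB, if_pos (Finset.mem_range.mp hi)]; field_simp; ring
    · simp [hB]
  simp only [Finset.prod_div_distrib]
  rw [numer t ht, denom t hmt]
  have n0 := numer 0 (by simpa using hα)
  have d0 := denom 0 (by simp)
  simp only [add_zero, mul_zero, Real.Gamma_one, mul_one] at n0 d0
  rw [n0, d0]
  have p1 : ((m + 1 : ℕ) : ℝ) ^ (-(α + (m + 1) * t))
      = ((m + 1 : ℕ) : ℝ) ^ (-α) * ((((m + 1 : ℕ) : ℝ) ^ (m + 1)) ^ t)⁻¹ := by
    rw [neg_add, Real.rpow_add hk0, ← Real.rpow_natCast, ← Real.rpow_mul hk0.le,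
      ← Real.rpow_neg hk0.le]
    push_cast; rfl
  have p2 : (m : ℝ) ^ (-(1 + m * t)) = (m : ℝ) ^ (-1 : ℝ) * (((m : ℝ) ^ m) ^ t)⁻¹ := by
    rw [neg_add, Real.rpow_add hm0, ← Real.rpow_natCast, ← Real.rpow_mul hm0.le,
      ← Real.rpow_neg hm0.le]
  have p3 : M ^ t = c ^ t * (((m + 1 : ℕ) : ℝ) ^ (m + 1)) ^ t / ((m : ℝ) ^ m) ^ t := by
    rw [hM, Real.div_rpow (by positivity) (by positivity), Real.mul_rpow hc.le (by positivity)]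
  rw [p1, p2, p3]
  have q1 := (Real.rpow_pos_of_pos hk0 (-α)).ne'
  have q2 := (Real.rpow_pos_of_pos hm0 (-1)).ne'
  have q3 : ((((m + 1 : ℕ) : ℝ) ^ (m + 1)) ^ t) ≠ 0 :=
    (Real.rpow_pos_of_pos (by positivity) t).ne'
  have q4 : (((m : ℝ) ^ m) ^ t) ≠ 0 := (Real.rpow_pos_of_pos (by positivity) t).ne'
  have g1 := (Real.Gamma_pos_of_pos hα).ne'
  have g2 := (Real.Gamma_pos_of_pos hmt).ne'
  have g3 := (Real.Gamma_pos_of_pos ht).ne'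
  have g4 : Real.Gamma (1 + t) ≠ 0 := by
    refine (Real.Gamma_pos_of_pos ?_).ne'
    nlinarith
  generalize ((m + 1 : ℕ) : ℝ) ^ (-α) = y1 at *
  generalize (m : ℝ) ^ (-1 : ℝ) = y2 at *
  generalize (((m + 1 : ℕ) : ℝ) ^ (m + 1)) ^ t = y3 at *
  generalize ((m : ℝ) ^ m) ^ t = y4 at *
  field_simp

/-- The factorization in law `x = p s ^ m τ`, with `p` and `s` exponentially distributed and `τ`
of law `ν`: both sides have the same power moments. -/
theorem eq_mulLaw_gamma_of_powMoment {m : ℕ} {α c : ℝ} (hα : 0 < α) (hα1 : α ≤ 1)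
    (hc : 0 < c) {ν : Measure ℝ} [IsProbabilityMeasure ν] (hν : ∀ᵐ x ∂ν, 0 < x)
    (hνt : ∀ t, 0 < α + (m + 1) * t → powMoment ν t = ENNReal.ofReal
        (c ^ t * Real.Gamma (α + (m + 1) * t) / (Real.Gamma α * Real.Gamma (1 + t) *
          Real.Gamma (1 + m * t))))
    {μ : Measure ℝ} [IsProbabilityMeasure μ] (hμ : ∀ᵐ x ∂μ, 0 < x)
    (hμt : ∀ t, 0 < α + (m + 1) * t → powMoment μ t = ENNReal.ofReal
        (c ^ t * Real.Gamma (α + (m + 1) * t) / Real.Gamma α)) :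
    μ = mulLaw (gammaMeasure 1 1)
      (mulLaw ((gammaMeasure 1 1).map fun x => x ^ (m : ℝ)) ν) := by
  have : IsProbabilityMeasure (gammaMeasure 1 1) :=
    isProbabilityMeasure_gammaMeasure one_pos one_pos
  have : IsProbabilityMeasure ((gammaMeasure 1 1).map fun x => x ^ (m : ℝ)) :=
    Measure.isProbabilityMeasure_map (by fun_prop)
  have h1 := ae_pos_gammaMeasure 1
  have h2 : ∀ᵐ x ∂((gammaMeasure 1 1).map fun x => x ^ (m : ℝ)), 0 < x := by
    rw [ae_map_iff (by fun_prop) measurableSet_Ioi]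
    filter_upwards [h1] with x hx using Real.rpow_pos_of_pos hx _
  have h3 := ae_mulLaw (r := fun x => 0 < x) h2 hν measurableSet_Ioi fun x y => mul_pos
  have hm0 : (0 : ℝ) ≤ m := Nat.cast_nonneg m
  have hk : (0 : ℝ) < m + 1 := by positivity
  have hdom : ∀ t, |t| < α / (m + 1) → 0 < α + (m + 1) * t := by
    intro t ht
    have := (abs_lt.mp ht).1
    rw [← neg_div, div_lt_iff₀ hk] at this
    linarith
  refine ext_of_powMoment (ε := α / (m + 1)) hμ
    (ae_mulLaw h1 h3 measurableSet_Ioi fun x y => mul_pos) (div_pos hα hk) (fun t ht => ?_)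
    fun t ht => ?_
  · rw [hμt t (hdom t ht)]; exact ENNReal.ofReal_ne_top
  have ht := hdom t ht
  have h1t : 0 < 1 + t := by nlinarith
  have hmt : 0 < 1 + m * t := by nlinarith
  rw [powMoment_mulLaw h1 t h3, powMoment_mulLaw h2 t hν, powMoment_map_rpow h1,
    powMoment_gammaMeasure one_pos h1t, powMoment_gammaMeasure one_pos hmt, hμt t ht, hνt t ht,
    ← ENNReal.ofReal_mul, ← ENNReal.ofReal_mul]
  · congr 1
    have g1 := (Real.Gamma_pos_of_pos hα).ne'
    have g2 := (Real.Gamma_pos_of_pos hmt).ne'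
    have g4 := (Real.Gamma_pos_of_pos h1t).ne'
    rw [Real.Gamma_one]
    field_simp
  · rw [Real.Gamma_one, div_one]; exact (Real.Gamma_pos_of_pos h1t).le
  · rw [Real.Gamma_one, div_one]; exact (Real.Gamma_pos_of_pos hmt).le

/-! ### Holomorphic integrals depending on a parameter -/

/-- Domination of the integrand alone suffices for holomorphy: Cauchy's estimate dominates the
derivative. -/
theorem differentiableOn_integral_of_dominated {X : Type*} [MeasurableSpace X] {μ : Measure X}
    {U : Set ℂ} (hU : IsOpen U) {F : ℂ → X → ℂ} {g : X → ℝ} (hg : Integrable g μ)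
    (hmeas : ∀ z ∈ U, AEStronglyMeasurable (F z) μ)
    (hd : ∀ᵐ x ∂μ, DifferentiableOn ℂ (fun z => F z x) U)
    (hb : ∀ᵐ x ∂μ, ∀ z ∈ U, ‖F z x‖ ≤ g x) :
    DifferentiableOn ℂ (fun z => ∫ x, F z x ∂μ) U := by
  intro z₀ hz₀
  obtain ⟨r, hr, hrU⟩ := Metric.isOpen_iff.mp hU z₀ hz₀
  have hr2 : 0 < r / 2 := half_pos hr
  have hball : ∀ z ∈ Metric.ball z₀ (r / 2), Metric.closedBall z (r / 4) ⊆ U := by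
    intro z hz y hy
    apply hrU
    rw [Metric.mem_ball] at hz ⊢
    rw [Metric.mem_closedBall] at hy
    linarith [dist_triangle y z z₀]
  have hsub : ∀ z ∈ Metric.ball z₀ (r / 2), z ∈ U := fun z hz =>
    hball z hz (Metric.mem_closedBall_self (by linarith))
  have h_diff : ∀ᵐ x ∂μ, ∀ z ∈ Metric.ball z₀ (r / 2),
      HasDerivAt (fun z => F z x) (deriv (fun z => F z x) z) z := by
    filter_upwards [hd] with x hx z hz
    exact (hx.differentiableAt (hU.mem_nhds (hsub z hz))).hasDerivAt
  have hF' : AEStronglyMeasurable (fun x => deriv (fun z => F z x) z₀) μ := by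
    -- the derivative is a limit of difference quotients along a sequence
    set δ : ℕ → ℂ := fun n => ((r / 2 * (1 / ((n : ℝ) + 2)) : ℝ) : ℂ) with hδ
    have hδpos : ∀ n : ℕ, 0 < r / 2 * (1 / ((n : ℝ) + 2)) := fun n => by positivity
    have hδ0 : Tendsto δ atTop (𝓝 0) := by
      have h1 : Tendsto (fun n : ℕ => r / 2 * (1 / ((n : ℝ) + 2))) atTop (𝓝 (r / 2 * 0)) := by
        refine Tendsto.const_mul _ ?_
        simp only [one_div]
        exact tendsto_inv_atTop_zero.comp
          (tendsto_atTop_add_const_right _ _ tendsto_natCast_atTop_atTop)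
      have := (Complex.continuous_ofReal.tendsto _).comp h1
      simpa [hδ, Function.comp_def] using this
    refine aestronglyMeasurable_of_tendsto_ae (u := atTop)
      (f := fun n x => (δ n)⁻¹ • (F (z₀ + δ n) x - F z₀ x)) (fun n => ?_) ?_
    · have hmem : z₀ + δ n ∈ U := hrU ?_
      · exact ((hmeas _ hmem).sub (hmeas _ hz₀)).const_smul (δ n)⁻¹
      rw [Metric.mem_ball, dist_eq_norm, add_sub_cancel_left, hδ, Complex.norm_real,
        Real.norm_of_nonneg (hδpos n).le]
      have : 1 / ((n : ℝ) + 2) ≤ 1 := by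
        rw [div_le_one (by positivity)]; linarith [(Nat.cast_nonneg n : (0 : ℝ) ≤ n)]
      nlinarith
    · filter_upwards [h_diff] with x hx
      have := (hasDerivAt_iff_tendsto_slope_zero.mp (hx z₀ (Metric.mem_ball_self hr2)))
      refine this.comp (tendsto_nhdsWithin_iff.mpr ⟨hδ0, Eventually.of_forall fun n => ?_⟩)
      simp only [hδ, mem_compl_iff, mem_singleton_iff, Complex.ofReal_eq_zero]
      exact (hδpos n).ne'
  have h_bound : ∀ᵐ x ∂μ, ∀ z ∈ Metric.ball z₀ (r / 2),
      ‖deriv (fun z => F z x) z‖ ≤ g x / (r / 4) := by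
    filter_upwards [hd, hb] with x hx hbx z hz
    refine Complex.norm_deriv_le_of_forall_mem_sphere_norm_le (by linarith)
      (hx.mono ?_).diffContOnCl fun y hy => hbx y (hball z hz (Metric.sphere_subset_closedBall hy))
    exact (Metric.closure_ball_subset_closedBall).trans (hball z hz)
  have hint : Integrable (F z₀) μ :=
    hg.mono' (hmeas z₀ hz₀) (hb.mono fun x hx => hx z₀ hz₀)
  exact (hasDerivAt_integral_of_dominated_loc_of_deriv_le (Metric.ball_mem_nhds z₀ hr2)
    ((hU.eventually_mem hz₀).mono hmeas) hint hF' h_bound (hg.div_const _)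
    h_diff).2.differentiableAt.differentiableWithinAt

/-! ### Stieltjes transforms of measures on a bounded interval -/

/-- The function `∫ (-τ) ^ N / (1 + u τ) dν(τ)`. For `N = 0` it is the Stieltjes transform of `ν`,
and `u ^ N` times it is the Taylor remainder of order `N` of that transform at the origin. -/
noncomputable def stieltjesTail (ν : Measure ℝ) (N : ℕ) (u : ℂ) : ℂ :=
  ∫ τ, (-(τ : ℂ)) ^ N / (1 + u * τ) ∂ν

theorem measurable_stieltjes_integrand (N : ℕ) (u : ℂ) :
    Measurable fun τ : ℝ => (-(τ : ℂ)) ^ N / (1 + u * τ) := by fun_prop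

theorem one_le_norm_one_add {u : ℂ} (hu : 0 < u.re) {τ : ℝ} (hτ : 0 < τ) :
    1 ≤ ‖1 + u * τ‖ := by
  refine le_trans ?_ (Complex.re_le_norm _)
  simp only [Complex.add_re, Complex.one_re, Complex.re_mul_ofReal]
  nlinarith

theorem norm_stieltjes_integrand_le {ν : Measure ℝ} {M : ℝ} (hν : ∀ᵐ τ ∂ν, 0 < τ ∧ τ ≤ M) (N : ℕ) {c : ℝ}
    (hc : 0 < c) {u : ℂ} (hu : ∀ τ : ℝ, 0 < τ → τ ≤ M → c ≤ ‖1 + u * τ‖) :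
    ∀ᵐ τ : ℝ ∂ν, ‖(-(τ : ℂ)) ^ N / (1 + u * τ)‖ ≤ M ^ N / c := by
  filter_upwards [hν] with τ hτ
  rw [norm_div, norm_pow, norm_neg, Complex.norm_real, Real.norm_of_nonneg hτ.1.le]
  have h := hu τ hτ.1 hτ.2
  have h2 : τ ^ N ≤ M ^ N := pow_le_pow_left₀ hτ.1.le hτ.2 N
  exact div_le_div₀ (pow_nonneg (hτ.1.le.trans hτ.2) N) h2 hc h

section
variable {ν : Measure ℝ} [IsProbabilityMeasure ν] {M : ℝ}

theorem norm_stieltjesTail_le (hν : ∀ᵐ τ ∂ν, 0 < τ ∧ τ ≤ M) (N : ℕ) {u : ℂ} (hu : 0 < u.re) :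
    ‖stieltjesTail ν N u‖ ≤ M ^ N := by
  have := norm_integral_le_of_norm_le_const (norm_stieltjes_integrand_le hν N one_pos
    (u := u) fun τ h _ => one_le_norm_one_add hu h)
  simpa [stieltjesTail] using this

theorem differentiableOn_stieltjesTail_of_le (hν : ∀ᵐ τ ∂ν, 0 < τ ∧ τ ≤ M) (N : ℕ) {U : Set ℂ}
    (hU : IsOpen U) {c : ℝ} (hc : 0 < c)
    (h : ∀ u ∈ U, ∀ τ : ℝ, 0 < τ → τ ≤ M → c ≤ ‖1 + u * τ‖) :
    DifferentiableOn ℂ (stieltjesTail ν N) U := by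
  refine differentiableOn_integral_of_dominated hU (integrable_const (M ^ N / c))
    (fun z _ => (measurable_stieltjes_integrand N z).aestronglyMeasurable) ?_ ?_
  · filter_upwards [hν] with τ hτ z hz
    have : 1 + z * (τ : ℂ) ≠ 0 := norm_pos_iff.mp (hc.trans_le (h z hz τ hτ.1 hτ.2))
    exact (by fun_prop (disch := exact this) :
      DifferentiableAt ℂ (fun z : ℂ => (-(τ : ℂ)) ^ N / (1 + z * τ)) z).differentiableWithinAt
  · filter_upwards [hν] with τ hτ z hz
    rw [norm_div, norm_pow, norm_neg, Complex.norm_real, Real.norm_of_nonneg hτ.1.le]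
    exact div_le_div₀ (pow_nonneg (hτ.1.le.trans hτ.2) N) (pow_le_pow_left₀ hτ.1.le hτ.2 N) hc
      (h z hz τ hτ.1 hτ.2)

theorem isOpen_re_pos : IsOpen {u : ℂ | 0 < u.re} := isOpen_lt continuous_const Complex.continuous_re

theorem differentiableOn_stieltjesTail (hν : ∀ᵐ τ ∂ν, 0 < τ ∧ τ ≤ M) (N : ℕ) :
    DifferentiableOn ℂ (stieltjesTail ν N) {u : ℂ | 0 < u.re} :=
  differentiableOn_stieltjesTail_of_le hν N isOpen_re_pos one_pos
    fun _ hu _ h _ => one_le_norm_one_add hu h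

theorem half_le_norm_one_add {u : ℂ} {τ : ℝ} (hu : ‖u‖ < (2 * M)⁻¹) (h0 : 0 < τ) (h : τ ≤ M) :
    1 / 2 ≤ ‖1 + u * τ‖ := by
  have hM : 0 < M := h0.trans_le h
  have h1 : ‖u * τ‖ ≤ 1 / 2 := by
    rw [norm_mul, Complex.norm_real, Real.norm_of_nonneg h0.le]
    calc ‖u‖ * τ ≤ (2 * M)⁻¹ * M := mul_le_mul hu.le h h0.le (by positivity)
      _ = 1 / 2 := by field_simp
  have h2 := norm_sub_norm_le (1 : ℂ) (-(u * τ))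
  rw [norm_neg, norm_one, sub_neg_eq_add] at h2
  linarith

theorem integrable_neg_pow (hν : ∀ᵐ τ ∂ν, 0 < τ ∧ τ ≤ M) (n : ℕ) :
    Integrable (fun τ : ℝ => (-(τ : ℂ)) ^ n) ν := by
  refine (integrable_const (M ^ n)).mono' (by fun_prop) ?_
  filter_upwards [hν] with τ hτ
  rw [norm_pow, norm_neg, Complex.norm_real, Real.norm_of_nonneg hτ.1.le]
  exact pow_le_pow_left₀ hτ.1.le hτ.2 n

theorem stieltjesTail_eq_sum_add (hν : ∀ᵐ τ ∂ν, 0 < τ ∧ τ ≤ M) (N : ℕ) {c : ℝ} (hc : 0 < c)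
    {u : ℂ} (hu : ∀ τ : ℝ, 0 < τ → τ ≤ M → c ≤ ‖1 + u * τ‖) :
    stieltjesTail ν 0 u = (∑ n ∈ Finset.range N, (∫ τ, (-(τ : ℂ)) ^ n ∂ν) * u ^ n)
      + u ^ N * stieltjesTail ν N u := by
  have hI : Integrable (fun τ : ℝ => (-(τ : ℂ)) ^ N / (1 + u * τ)) ν :=
    (integrable_const _).mono' (measurable_stieltjes_integrand N u).aestronglyMeasurable
      (norm_stieltjes_integrand_le hν N hc hu)
  have hS : ∀ n ∈ Finset.range N, Integrable (fun τ : ℝ => (-(τ : ℂ)) ^ n * u ^ n) ν :=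
    fun n _ => (integrable_neg_pow hν n).mul_const _
  simp only [stieltjesTail]
  rw [← integral_const_mul]
  simp only [← integral_mul_const]
  rw [← integral_finsetSum _ hS, ← integral_add (integrable_finsetSum _ hS) (hI.const_mul _)]
  refine integral_congr_ae ?_
  filter_upwards [hν] with τ hτ
  have h0 : 1 + u * (τ : ℂ) ≠ 0 := norm_pos_iff.mp (hc.trans_le (hu τ hτ.1 hτ.2))
  have hg := mul_neg_geom_sum (-(u * (τ : ℂ))) N
  have e : ∑ n ∈ Finset.range N, (-(τ : ℂ)) ^ n * u ^ n
      = ∑ n ∈ Finset.range N, (-(u * (τ : ℂ))) ^ n :=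
    Finset.sum_congr rfl fun n _ => by rw [← mul_pow]; ring
  have e2 : u ^ N * ((-(τ : ℂ)) ^ N / (1 + u * τ)) = (-(u * (τ : ℂ))) ^ N / (1 + u * τ) := by
    rw [← mul_div_assoc, ← mul_pow]; ring
  rw [e, e2, pow_zero]
  field_simp
  linear_combination -hg

theorem hasSum_stieltjesTail (hν : ∀ᵐ τ ∂ν, 0 < τ ∧ τ ≤ M) {u : ℂ} (hu : ‖u‖ < (2 * M)⁻¹) :
    HasSum (fun n : ℕ => (∫ τ, (-(τ : ℂ)) ^ n ∂ν) * u ^ n) (stieltjesTail ν 0 u) := by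
  have hM : 0 < M := by
    obtain ⟨τ, h⟩ := hν.exists
    exact h.1.trans_le h.2
  have hq : ‖u‖ * M < 1 / 2 := by
    calc ‖u‖ * M < (2 * M)⁻¹ * M := (mul_lt_mul_iff_left₀ hM).mpr hu
      _ = 1 / 2 := by field_simp
  have hq0 : 0 ≤ ‖u‖ * M := by positivity
  have hterm : ∀ n, ‖(∫ τ, (-(τ : ℂ)) ^ n ∂ν) * u ^ n‖ ≤ (‖u‖ * M) ^ n := by
    intro n
    have : ‖∫ τ, (-(τ : ℂ)) ^ n ∂ν‖ ≤ M ^ n := by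
      have := norm_integral_le_of_norm_le_const (μ := ν) (f := fun τ : ℝ => (-(τ : ℂ)) ^ n)
        (C := M ^ n) (by
          filter_upwards [hν] with τ hτ
          rw [norm_pow, norm_neg, Complex.norm_real, Real.norm_of_nonneg hτ.1.le]
          exact pow_le_pow_left₀ hτ.1.le hτ.2 n)
      simpa using this
    rw [norm_mul, norm_pow, mul_pow, mul_comm]
    exact mul_le_mul_of_nonneg_left this (by positivity)
  have hsum : Summable fun n : ℕ => (∫ τ, (-(τ : ℂ)) ^ n ∂ν) * u ^ n :=
    Summable.of_norm_bounded (summable_geometric_of_lt_one hq0 (by linarith)) hterm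
  rw [hsum.hasSum_iff_tendsto_nat]
  have hc : ∀ τ : ℝ, 0 < τ → τ ≤ M → (1 / 2 : ℝ) ≤ ‖1 + u * τ‖ :=
    fun τ h0 h => half_le_norm_one_add hu h0 h
  have hrem : Tendsto (fun N => u ^ N * stieltjesTail ν N u) atTop (𝓝 0) := by
    refine squeeze_zero_norm (a := fun N => 2 * (‖u‖ * M) ^ N) (fun N => ?_) ?_
    · have := norm_integral_le_of_norm_le_const
        (norm_stieltjes_integrand_le hν N one_half_pos hc)
      rw [probReal_univ, mul_one] at this
      rw [norm_mul, norm_pow, mul_pow]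
      calc ‖u‖ ^ N * ‖stieltjesTail ν N u‖ ≤ ‖u‖ ^ N * (M ^ N / (1 / 2)) :=
            mul_le_mul_of_nonneg_left this (by positivity)
        _ = 2 * (‖u‖ ^ N * M ^ N) := by ring
    · simpa using (tendsto_pow_atTop_nhds_zero_of_lt_one hq0 (by linarith)).const_mul 2
  have : Tendsto (fun N => stieltjesTail ν 0 u - u ^ N * stieltjesTail ν N u) atTop
      (𝓝 (stieltjesTail ν 0 u - 0)) := tendsto_const_nhds.sub hrem
  rw [sub_zero] at this
  refine this.congr fun N => ?_
  rw [stieltjesTail_eq_sum_add hν N one_half_pos hc]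
  ring
end

/-! ### Laplace integrals along rays -/

theorem integrableOn_pow_mul_exp_neg_mul (n : ℕ) {b : ℝ} (hb : 0 < b) :
    IntegrableOn (fun s : ℝ => s ^ n * Real.exp (-(b * s))) (Ioi 0) := by
  have := integrableOn_rpow_mul_exp_neg_mul_rpow (p := 1) (s := n) (b := b)
    (by linarith [(Nat.cast_nonneg n : (0 : ℝ) ≤ n)]) one_pos hb
  simpa [Real.rpow_natCast, neg_mul] using this

theorem integral_pow_mul_exp_neg_mul (n : ℕ) {b : ℝ} (hb : 0 < b) :
    ∫ s in Ioi (0 : ℝ), s ^ n * Real.exp (-(b * s)) = n.factorial / b ^ (n + 1) := by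
  have := Real.integral_rpow_mul_exp_neg_mul_Ioi (a := n + 1) (r := b) (by positivity) hb
  rw [Real.Gamma_nat_eq_factorial] at this
  simp only [add_sub_cancel_right, Real.rpow_natCast] at this
  rw [this, ← Nat.cast_succ, Real.rpow_natCast, one_div, inv_pow]
  field_simp

theorem norm_cexp_neg_mul_ofReal (z : ℂ) (s : ℝ) :
    ‖Complex.exp (-(z * s))‖ = Real.exp (-(z.re * s)) := by
  rw [Complex.norm_exp]; simp

theorem integrableOn_pow_mul_cexp_neg_mul (n : ℕ) {z : ℂ} (hz : 0 < z.re) :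
    IntegrableOn (fun s : ℝ => (s : ℂ) ^ n * Complex.exp (-(z * s))) (Ioi 0) := by
  refine (integrableOn_pow_mul_exp_neg_mul n hz).mono' (by fun_prop) ?_
  filter_upwards [self_mem_ae_restrict measurableSet_Ioi] with s hs
  rw [norm_mul, norm_pow, Complex.norm_real, Real.norm_of_nonneg (le_of_lt hs),
    norm_cexp_neg_mul_ofReal]

theorem tendsto_pow_mul_cexp_neg_mul (n : ℕ) {z : ℂ} (hz : 0 < z.re) :
    Tendsto (fun s : ℝ => (s : ℂ) ^ n * Complex.exp (-(z * s))) atTop (𝓝 0) := by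
  rw [tendsto_zero_iff_norm_tendsto_zero]
  refine (tendsto_rpow_mul_exp_neg_mul_atTop_nhds_zero n z.re hz).congr' ?_
  filter_upwards [eventually_ge_atTop 0] with s hs
  rw [norm_mul, norm_pow, Complex.norm_real, Real.norm_of_nonneg hs,
    norm_cexp_neg_mul_ofReal, Real.rpow_natCast, neg_mul]

theorem integral_pow_mul_cexp_neg_mul (n : ℕ) {z : ℂ} (hz : 0 < z.re) :
    ∫ s in Ioi (0 : ℝ), (s : ℂ) ^ n * Complex.exp (-(z * s)) = n.factorial / z ^ (n + 1) := by
  have hz0 : z ≠ 0 := by rintro rfl; simp at hz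
  induction n with
  | zero =>
    have := integral_exp_mul_complex_Ioi (a := -z) (by simpa using hz) 0
    simp only [neg_mul, Complex.ofReal_zero, mul_zero, Complex.exp_zero] at this
    simp [this]
  | succ n ih =>
    have hd : ∀ s ∈ Ioi (0 : ℝ), HasDerivAt
        (fun s : ℝ => (s : ℂ) ^ (n + 1) * Complex.exp (-(z * s)))
        (((n + 1 : ℕ) : ℂ) * ((s : ℂ) ^ n * Complex.exp (-(z * s)))
          - z * ((s : ℂ) ^ (n + 1) * Complex.exp (-(z * s)))) s := by
      intro s _
      have h1 : HasDerivAt (fun s : ℂ => s ^ (n + 1)) (((n + 1 : ℕ) : ℂ) * (s : ℂ) ^ n) (s : ℂ) := by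
        simpa using hasDerivAt_pow (n + 1) (s : ℂ)
      have h2 : HasDerivAt (fun s : ℂ => Complex.exp (-(z * s)))
          (Complex.exp (-(z * s)) * (-(z * 1))) (s : ℂ) :=
        (((hasDerivAt_id (s : ℂ)).const_mul z).neg).cexp
      exact ((h1.mul h2).comp_ofReal).congr_deriv (by ring)
    have hi1 := (integrableOn_pow_mul_cexp_neg_mul n hz).const_mul (((n + 1 : ℕ) : ℂ))
    have hi2 := (integrableOn_pow_mul_cexp_neg_mul (n + 1) hz).const_mul z
    have key := integral_Ioi_of_hasDerivAt_of_tendsto (a := (0 : ℝ))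
      (f := fun s : ℝ => (s : ℂ) ^ (n + 1) * Complex.exp (-(z * s)))
      (Continuous.continuousWithinAt (by fun_prop)) hd (hi1.sub hi2)
      (tendsto_pow_mul_cexp_neg_mul (n + 1) hz)
    rw [integral_sub hi1 hi2, integral_const_mul, integral_const_mul, ih] at key
    simp only [Complex.ofReal_zero, ne_eq, Nat.add_eq_zero_iff, one_ne_zero, and_false,
      not_false_eq_true, zero_pow, zero_mul, sub_zero] at key
    have h3 := sub_eq_zero.mp key
    rw [← mul_right_inj' hz0, ← h3, Nat.factorial_succ]
    push_cast
    field_simp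
    ring

/-- The Laplace integral `∫ z exp (-z s) Φ(λ (z s) ^ m) ds` over `s > 0`, which is
`∫ exp (-y) Φ(λ y ^ m) dy` along the ray `y = z s`. Both `λ = exp w` and `z = exp ζ` are given by their
logarithms, so that `λ` may lie on any sheet of the surface of the logarithm. -/
noncomputable def rayLaplace (m : ℕ) (Φ : ℂ → ℂ) (w ζ : ℂ) : ℂ :=
  ∫ s in Ioi (0 : ℝ), Complex.exp ζ * Complex.exp (-(Complex.exp ζ * s)) *
    Φ (Complex.exp (w + m * ζ) * (s : ℂ) ^ m)

theorem mul_pow_re_pos {P : ℂ} (hP : 0 < P.re) (m : ℕ) {s : ℝ} (hs : 0 < s) :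
    0 < (P * (s : ℂ) ^ m).re := by
  rw [← Complex.ofReal_pow, Complex.re_mul_ofReal]
  positivity

theorem aestronglyMeasurable_ray {m : ℕ} {Φ : ℂ → ℂ} (hΦ : ContinuousOn Φ {u | 0 < u.re}) {z P : ℂ}
    (hP : 0 < P.re) :
    AEStronglyMeasurable (fun s : ℝ => z * Complex.exp (-(z * s)) * Φ (P * (s : ℂ) ^ m))
      (volume.restrict (Ioi 0)) := by
  refine ContinuousOn.aestronglyMeasurable ?_ measurableSet_Ioi
  refine ContinuousOn.mul (by fun_prop) (hΦ.comp (by fun_prop) fun s hs => ?_)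
  exact mul_pow_re_pos hP m hs

theorem norm_ray_integrand_le {m N : ℕ} {Ψ : ℂ → ℂ} {C : ℝ}
    (hC : ∀ u : ℂ, 0 < u.re → ‖Ψ u‖ ≤ C) {z P : ℂ} (hP : 0 < P.re) {s : ℝ} (hs : 0 < s) :
    ‖z * Complex.exp (-(z * s)) * ((P * (s : ℂ) ^ m) ^ N * Ψ (P * (s : ℂ) ^ m))‖ ≤
      C * ‖z‖ * ‖P‖ ^ N * (s ^ (m * N) * Real.exp (-(z.re * s))) := by
  rw [norm_mul, norm_mul, norm_mul, norm_pow, norm_mul, norm_pow, Complex.norm_real,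
    Real.norm_of_nonneg hs.le, norm_cexp_neg_mul_ofReal, mul_pow, ← pow_mul]
  have := hC _ (mul_pow_re_pos hP m hs)
  calc _ = ‖z‖ * ‖P‖ ^ N * (s ^ (m * N) * Real.exp (-(z.re * s))) * ‖Ψ (P * (s : ℂ) ^ m)‖ := by ring
    _ ≤ ‖z‖ * ‖P‖ ^ N * (s ^ (m * N) * Real.exp (-(z.re * s))) * C :=
        mul_le_mul_of_nonneg_left this (by positivity)
    _ = _ := by ring

theorem integrableOn_ray {m N : ℕ} {Ψ : ℂ → ℂ} {C : ℝ} (hΨ : ContinuousOn Ψ {u | 0 < u.re})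
    (hC : ∀ u : ℂ, 0 < u.re → ‖Ψ u‖ ≤ C) {z P : ℂ} (hz : 0 < z.re) (hP : 0 < P.re) :
    IntegrableOn (fun s : ℝ =>
      z * Complex.exp (-(z * s)) * ((P * (s : ℂ) ^ m) ^ N * Ψ (P * (s : ℂ) ^ m))) (Ioi 0) := by
  refine ((integrableOn_pow_mul_exp_neg_mul (m * N) hz).const_mul (C * ‖z‖ * ‖P‖ ^ N)).mono'
    (aestronglyMeasurable_ray (Φ := fun u => u ^ N * Ψ u) (by fun_prop) hP) ?_
  filter_upwards [self_mem_ae_restrict measurableSet_Ioi] with s hs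
  exact norm_ray_integrand_le hC hP hs

theorem norm_integral_ray_le {m N : ℕ} {Ψ : ℂ → ℂ} {C : ℝ}
    (hC : ∀ u : ℂ, 0 < u.re → ‖Ψ u‖ ≤ C) {z P : ℂ} (hz : 0 < z.re) (hP : 0 < P.re) :
    ‖∫ s in Ioi (0 : ℝ), z * Complex.exp (-(z * s)) *
      ((P * (s : ℂ) ^ m) ^ N * Ψ (P * (s : ℂ) ^ m))‖ ≤
      C * ‖z‖ * ‖P‖ ^ N * ((m * N).factorial / z.re ^ (m * N + 1)) := by
  rw [← integral_pow_mul_exp_neg_mul (m * N) hz, ← integral_const_mul]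
  refine norm_integral_le_of_norm_le
    ((integrableOn_pow_mul_exp_neg_mul (m * N) hz).const_mul _) ?_
  filter_upwards [self_mem_ae_restrict measurableSet_Ioi] with s hs
  exact norm_ray_integrand_le hC hP hs

theorem rayLaplace_pow (m n : ℕ) (w ζ : ℂ) (hz : 0 < (Complex.exp ζ).re) :
    rayLaplace m (fun u => u ^ n) w ζ = (m * n).factorial * Complex.exp w ^ n := by
  have e : ∀ s : ℝ, Complex.exp ζ * Complex.exp (-(Complex.exp ζ * s)) *
      (Complex.exp (w + m * ζ) * (s : ℂ) ^ m) ^ n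
      = (Complex.exp ζ ^ (m * n + 1) * Complex.exp w ^ n) *
        ((s : ℂ) ^ (m * n) * Complex.exp (-(Complex.exp ζ * s))) := by
    intro s
    rw [Complex.exp_add, Complex.exp_nat_mul, mul_pow, mul_pow, ← pow_mul, ← pow_mul]
    ring
  simp only [rayLaplace, e]
  rw [integral_const_mul, integral_pow_mul_cexp_neg_mul _ hz]
  have := Complex.exp_ne_zero ζ
  field_simp

theorem differentiableAt_rayLaplace {m : ℕ} {Φ : ℂ → ℂ} {C : ℝ}
    (hΦ : DifferentiableOn ℂ Φ {u | 0 < u.re}) (hC : ∀ u : ℂ, 0 < u.re → ‖Φ u‖ ≤ C)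
    {w ζ : ℂ → ℂ} (hw : Differentiable ℂ w) (hζ : Differentiable ℂ ζ) {v : ℂ}
    (hz : 0 < (Complex.exp (ζ v)).re) (hP : 0 < (Complex.exp (w v + m * ζ v)).re) :
    DifferentiableAt ℂ (fun v => rayLaplace m Φ (w v) (ζ v)) v := by
  set κ := (Complex.exp (ζ v)).re / 2 with hκ
  have hκ0 : 0 < κ := half_pos hz
  set K := ‖Complex.exp (ζ v)‖ + 1 with hK
  have hwc := hw.continuous
  have hζc := hζ.continuous
  set U : Set ℂ := {v | κ < (Complex.exp (ζ v)).re} ∩ {v | ‖Complex.exp (ζ v)‖ < K} ∩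
    {v | 0 < (Complex.exp (w v + m * ζ v)).re} with hU
  have hUo : IsOpen U :=
    ((isOpen_lt (by fun_prop) (by fun_prop)).inter (isOpen_lt (by fun_prop) (by fun_prop))).inter
      (isOpen_lt (by fun_prop) (by fun_prop))
  have hv : v ∈ U := ⟨⟨by simp only [mem_ofPred_eq]; linarith, by simp [hK]⟩, hP⟩
  have hC0 : 0 ≤ C := (norm_nonneg _).trans (hC 1 (by simp))
  refine (differentiableOn_integral_of_dominated hUo
    (g := fun s : ℝ => C * K * (s ^ 0 * Real.exp (-(κ * s))))
    ((integrableOn_pow_mul_exp_neg_mul 0 hκ0).const_mul _)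
    (fun y hy => aestronglyMeasurable_ray hΦ.continuousOn hy.2) ?_ ?_).differentiableAt
      (hUo.mem_nhds hv)
  · filter_upwards [self_mem_ae_restrict measurableSet_Ioi] with s hs y hy
    have h1 : DifferentiableAt ℂ Φ (Complex.exp (w y + m * ζ y) * (s : ℂ) ^ m) :=
      hΦ.differentiableAt (isOpen_re_pos.mem_nhds (mul_pow_re_pos hy.2 m hs))
    have h2 : DifferentiableAt ℂ (fun y => Complex.exp (w y + m * ζ y) * (s : ℂ) ^ m) y := by
      fun_prop
    have h3 : DifferentiableAt ℂ (fun y => Φ (Complex.exp (w y + m * ζ y) * (s : ℂ) ^ m)) y :=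
      h1.comp y h2
    exact (DifferentiableAt.mul (by fun_prop) h3).differentiableWithinAt
  · filter_upwards [self_mem_ae_restrict measurableSet_Ioi] with s hs y hy
    have := norm_ray_integrand_le (m := m) (N := 0) hC (z := Complex.exp (ζ y)) hy.2 hs
    simp only [pow_zero, one_mul, mul_one, mul_zero] at this ⊢
    refine this.trans ?_
    have h1 : Real.exp (-((Complex.exp (ζ y)).re * s)) ≤ Real.exp (-(κ * s)) := by
      apply Real.exp_le_exp.mpr
      have := hy.1.1
      have hs' : 0 < s := hs
      simp only [mem_ofPred_eq] at this
      nlinarith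
    have h2 : ‖Complex.exp (ζ y)‖ ≤ K := le_of_lt hy.1.2
    gcongr

theorem rayLaplace_add_ofReal (m : ℕ) (Φ : ℂ → ℂ) (w ζ : ℂ) (a : ℝ) :
    rayLaplace m Φ w (ζ + a) = rayLaplace m Φ w ζ := by
  have h := integral_comp_mul_left_Ioi' (fun s : ℝ => Complex.exp ζ *
    Complex.exp (-(Complex.exp ζ * s)) * Φ (Complex.exp (w + m * ζ) * (s : ℂ) ^ m)) 0
    (Real.exp_pos a)
  rw [mul_zero, ← integral_smul] at h
  rw [rayLaplace, rayLaplace, ← h]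
  refine setIntegral_congr_fun measurableSet_Ioi fun s _ => ?_
  simp only [Complex.real_smul]
  have e1 : Complex.exp (ζ + a) = Complex.exp ζ * (Real.exp a : ℝ) := by
    rw [Complex.exp_add, Complex.ofReal_exp]
  have e2 : Complex.exp (w + m * (ζ + a)) = Complex.exp (w + m * ζ) * ((Real.exp a : ℝ) : ℂ) ^ m := by
    rw [mul_add, ← add_assoc, Complex.exp_add, Complex.ofReal_exp, Complex.exp_nat_mul _ m]
  rw [e1, e2]
  push_cast
  rw [mul_pow]
  ring_nf

theorem exp_re_pos_of_abs_im_lt {ζ : ℂ} (h : |ζ.im| < Real.pi / 2) : 0 < (Complex.exp ζ).re := by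
  rw [Complex.exp_re]
  exact mul_pos (Real.exp_pos _) (Real.cos_pos_of_mem_Ioo (abs_lt.mp h))

/-- Rotation of the ray of integration, without a contour argument: as a function of `ζ` the
integral is holomorphic, and it depends on `im ζ` only. -/
theorem rayLaplace_congr_ray {m : ℕ} {Φ : ℂ → ℂ} {C : ℝ}
    (hΦ : DifferentiableOn ℂ Φ {u | 0 < u.re}) (hC : ∀ u : ℂ, 0 < u.re → ‖Φ u‖ ≤ C)
    {w ζ₁ ζ₂ : ℂ} (h₁ : |ζ₁.im| < Real.pi / 2) (h₁' : |w.im + m * ζ₁.im| < Real.pi / 2)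
    (h₂ : |ζ₂.im| < Real.pi / 2) (h₂' : |w.im + m * ζ₂.im| < Real.pi / 2) :
    rayLaplace m Φ w ζ₁ = rayLaplace m Φ w ζ₂ := by
  set S : Set ℝ := {y | |y| < Real.pi / 2} ∩ {y | |w.im + m * y| < Real.pi / 2} with hS
  have hSo : IsOpen S :=
    (isOpen_lt (by fun_prop) (by fun_prop)).inter (isOpen_lt (by fun_prop) (by fun_prop))
  have hSc : Convex ℝ S := by
    rw [convex_iff_ordConnected]
    refine ⟨fun x hx y hy t ht => ⟨?_, ?_⟩⟩
    · exact abs_lt.mpr ⟨(abs_lt.mp hx.1).1.trans_le ht.1, ht.2.trans_lt (abs_lt.mp hy.1).2⟩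
    · have hm : (0 : ℝ) ≤ m := Nat.cast_nonneg m
      have hx2 : |w.im + m * x| < Real.pi / 2 := hx.2
      have hy2 : |w.im + m * y| < Real.pi / 2 := hy.2
      refine abs_lt.mpr ⟨(abs_lt.mp hx2).1.trans_le ?_, lt_of_le_of_lt ?_ (abs_lt.mp hy2).2⟩
      · have := mul_le_mul_of_nonneg_left ht.1 hm; linarith
      · have := mul_le_mul_of_nonneg_left ht.2 hm; linarith
  set U : Set ℂ := Complex.imLm ⁻¹' S with hU
  have hUo : IsOpen U := hSo.preimage Complex.continuous_im
  have hUc : Convex ℝ U := hSc.linear_preimage _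
  have hd : ∀ ζ ∈ U, DifferentiableAt ℂ (rayLaplace m Φ w) ζ := fun ζ hζ =>
    differentiableAt_rayLaplace (w := fun _ => w) (ζ := fun ζ => ζ) hΦ hC (by fun_prop)
      (by fun_prop) (exp_re_pos_of_abs_im_lt hζ.1) (exp_re_pos_of_abs_im_lt (by simpa using hζ.2))
  refine hUo.is_const_of_deriv_eq_zero hUc.isPreconnected
    (fun ζ hζ => (hd ζ hζ).differentiableWithinAt) (fun ζ hζ => ?_) (show ζ₁ ∈ U from ⟨h₁, h₁'⟩)
    (show ζ₂ ∈ U from ⟨h₂, h₂'⟩)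
  -- invariance under real translations makes the derivative along the real direction vanish
  have h1 : HasDerivAt (rayLaplace m Φ w) (deriv (rayLaplace m Φ w) ζ) (ζ + ((0 : ℝ) : ℂ)) := by
    simpa using (hd ζ hζ).hasDerivAt
  have h2 : HasDerivAt (fun a : ℂ => ζ + a) 1 ((0 : ℝ) : ℂ) := (hasDerivAt_id _).const_add ζ
  have h3 := (HasDerivAt.comp ((0 : ℝ) : ℂ) h1 h2).comp_ofReal
  simp only [Function.comp_apply, rayLaplace_add_ofReal, mul_one] at h3
  exact h3.unique (hasDerivAt_const _ _)

/-! ### From asymptotic expansions to Taylor's formula at the origin -/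

theorem intervalIntegrable_taylor_kernel {h : ℝ → ℂ} (hh : ContinuousOn h (Icc 0 1)) (N : ℕ) :
    IntervalIntegrable (fun t : ℝ => (((1 - t) ^ N / (N.factorial : ℝ) : ℝ) : ℂ) * h t) volume 0 1 := by
  refine ContinuousOn.intervalIntegrable ?_
  rw [uIcc_of_le zero_le_one]
  exact ContinuousOn.mul (Continuous.continuousOn (by fun_prop)) hh

/-- Taylor's formula on `[0, 1]` with integral remainder, for a chain of functions each of which is,
up to the factor `L`, the derivative of the preceding one in the interior. -/
theorem taylor_integral_of_hasDerivAt {h : ℕ → ℝ → ℂ} {L : ℂ}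
    (hc : ∀ n, ContinuousOn (h n) (Icc 0 1))
    (hd : ∀ n, ∀ t ∈ Ioo (0 : ℝ) 1, HasDerivAt (h n) (L * h (n + 1) t) t) (N : ℕ) :
    h 0 1 = (∑ n ∈ Finset.range (N + 1), h n 0 / n.factorial * L ^ n) + L ^ (N + 1) *
      ∫ t in (0 : ℝ)..1, (((1 - t) ^ N / (N.factorial : ℝ) : ℝ) : ℂ) * h (N + 1) t := by
  have hint : ∀ n, IntervalIntegrable (fun t => L * h n t) volume 0 1 := fun n => by
    refine ContinuousOn.intervalIntegrable ?_
    rw [uIcc_of_le zero_le_one]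
    exact continuousOn_const.mul (hc n)
  induction N with
  | zero =>
    have := intervalIntegral.integral_eq_sub_of_hasDerivAt_of_le zero_le_one (hc 0) (hd 0) (hint 1)
    rw [intervalIntegral.integral_const_mul] at this
    simp [this]
  | succ N ih =>
    set v : ℝ → ℂ := fun t => ((-((1 - t) ^ (N + 1) / ((N + 1).factorial : ℝ)) : ℝ) : ℂ) with hv
    have hv' : ∀ t : ℝ, HasDerivAt v (((1 - t) ^ N / (N.factorial : ℝ) : ℝ) : ℂ) t := by
      intro t
      have h1 : HasDerivAt (fun t : ℝ => 1 - t) (-1) t := by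
        simpa using (hasDerivAt_id t).const_sub 1
      have h2 := ((h1.pow (N + 1)).div_const ((N + 1).factorial : ℝ)).neg
      have h3 : HasDerivAt (fun t : ℝ => -((1 - t) ^ (N + 1) / ((N + 1).factorial : ℝ)))
          ((1 - t) ^ N / (N.factorial : ℝ)) t := by
        refine h2.congr_deriv ?_
        rw [Nat.factorial_succ]
        push_cast
        field_simp
      exact h3.ofReal_comp
    have hvc : Continuous v := by fun_prop
    have key := intervalIntegral.integral_mul_deriv_eq_deriv_mul_of_hasDerivAt
      (a := (0 : ℝ)) (b := 1) (u := h (N + 1)) (v := v)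
      (by rw [uIcc_of_le zero_le_one]; exact hc _) hvc.continuousOn
      (by simpa using fun t h0 h1 => hd (N + 1) t ⟨h0, h1⟩) (fun t _ => hv' t) (hint (N + 2))
      (Continuous.intervalIntegrable (by fun_prop) _ _)
    have e1 : v 1 = 0 := by simp [hv]
    have e0 : v 0 = -(1 / ((N + 1).factorial : ℂ)) := by simp [hv]
    have e2 : ∫ t in (0 : ℝ)..1, L * h (N + 2) t * v t
        = -(L * ∫ t in (0 : ℝ)..1,
            (((1 - t) ^ (N + 1) / ((N + 1).factorial : ℝ) : ℝ) : ℂ) * h (N + 2) t) := by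
      rw [← intervalIntegral.integral_const_mul, ← intervalIntegral.integral_neg]
      refine intervalIntegral.integral_congr fun t _ => ?_
      simp only [hv]; push_cast; ring
    have e3 : ∫ t in (0 : ℝ)..1, (((1 - t) ^ N / (N.factorial : ℝ) : ℝ) : ℂ) * h (N + 1) t
        = ∫ t in (0 : ℝ)..1, h (N + 1) t * (((1 - t) ^ N / (N.factorial : ℝ) : ℝ) : ℂ) :=
      intervalIntegral.integral_congr fun t _ => mul_comm _ _
    rw [ih, Finset.sum_range_succ _ (N + 1), e3, key, e2, e1, e0]
    ring

/-- `G` is holomorphic in the strip `|im w| < r` and has there, uniformly, the asymptotic expansion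
`∑ a n λ ^ n` to all orders in `λ = exp w`. The strip is the sector `|arg λ| < r` of the surface of the
logarithm; it has no bound on `|λ|`, so every estimate holds for large `λ` as well. -/
def HasStripExpansion (a : ℕ → ℂ) (r : ℝ) (G : ℂ → ℂ) : Prop :=
  DifferentiableOn ℂ G {w | |w.im| < r} ∧ ∀ N : ℕ, ∃ C : ℝ, ∀ w : ℂ, |w.im| < r →
    ‖G w - ∑ n ∈ Finset.range N, a n * Complex.exp w ^ n‖ ≤ C * ‖Complex.exp w‖ ^ N

theorem isOpen_strip (r : ℝ) : IsOpen {w : ℂ | |w.im| < r} :=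
  isOpen_lt (by fun_prop) (by fun_prop)

/-- Asymptotic expansions can be differentiated with respect to `exp w`, at the price of a
narrower strip: this is Cauchy's estimate for the remainder. -/
theorem HasStripExpansion.deriv {a : ℕ → ℂ} {r r' : ℝ} {G : ℂ → ℂ} (h : HasStripExpansion a r G)
    (hr : r' < r) : HasStripExpansion (fun n => (n + 1) * a (n + 1)) r'
      (fun w => (Complex.exp w)⁻¹ * deriv G w) := by
  obtain ⟨hd, hb⟩ := h
  have hmono : {w : ℂ | |w.im| < r'} ⊆ {w | |w.im| < r} := fun w hw => lt_trans hw hr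
  refine ⟨?_, fun N => ?_⟩
  · refine DifferentiableOn.mul (fun w _ => ?_) ((hd.deriv (isOpen_strip r)).mono hmono)
    exact (DifferentiableAt.inv (by fun_prop) (Complex.exp_ne_zero w)).differentiableWithinAt
  obtain ⟨C, hC⟩ := hb (N + 1)
  set δ := (r - r') / 2 with hδ
  have hδ0 : 0 < δ := by rw [hδ]; linarith
  refine ⟨C * Real.exp δ ^ (N + 1) / δ, fun w hw => ?_⟩
  have hball : Metric.closedBall w δ ⊆ {w : ℂ | |w.im| < r} := by
    intro y hy
    have h1 : |(y - w).im| ≤ δ := (Complex.abs_im_le_norm _).trans (by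
      rwa [Metric.mem_closedBall, dist_eq_norm] at hy)
    have h2 := abs_add_le (y - w).im w.im
    simp only [Complex.sub_im, sub_add_cancel] at h1 h2
    show |y.im| < r
    linarith
  set E : ℂ → ℂ := fun v => G v - ∑ n ∈ Finset.range (N + 1), a n * Complex.exp v ^ n with hE
  have hEd : DifferentiableOn ℂ E {w | |w.im| < r} :=
    hd.sub (Differentiable.differentiableOn (by fun_prop))
  have hC0 : 0 ≤ C := by
    have := (norm_nonneg _).trans (hC w (hmono hw))
    exact nonneg_of_mul_nonneg_left this (pow_pos (norm_pos_iff.mpr (Complex.exp_ne_zero w)) _)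
  have hbound : ‖_root_.deriv E w‖ ≤ C * (‖Complex.exp w‖ * Real.exp δ) ^ (N + 1) / δ := by
    refine Complex.norm_deriv_le_of_forall_mem_sphere_norm_le hδ0
      (hEd.mono ((Metric.closure_ball_subset_closedBall).trans hball)).diffContOnCl fun y hy => ?_
    have hy' := Metric.sphere_subset_closedBall hy
    refine (hC y (hball hy')).trans ?_
    have : ‖Complex.exp y‖ ≤ ‖Complex.exp w‖ * Real.exp δ := by
      rw [Complex.norm_exp, Complex.norm_exp, ← Real.exp_add]
      apply Real.exp_le_exp.mpr
      have h1 : |(y - w).re| ≤ δ := (Complex.abs_re_le_norm _).trans (by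
        rwa [Metric.mem_closedBall, dist_eq_norm] at hy')
      have := (abs_le.mp h1).2
      simp only [Complex.sub_re] at this
      linarith
    gcongr
  have hGd : DifferentiableAt ℂ G w := hd.differentiableAt ((isOpen_strip r).mem_nhds (hmono hw))
  have hEderiv : HasDerivAt E (_root_.deriv G w -
      ∑ n ∈ Finset.range (N + 1), a n * (n * Complex.exp w ^ n)) w := by
    refine hGd.hasDerivAt.sub (HasDerivAt.fun_sum fun n _ => HasDerivAt.const_mul _ ?_)
    have h1 : HasDerivAt (fun w : ℂ => Complex.exp (n * w)) (Complex.exp (n * w) * (n * 1)) w :=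
      ((hasDerivAt_id w).const_mul (n : ℂ)).cexp
    simp only [Complex.exp_nat_mul] at h1
    exact h1.congr_deriv (by ring)
  rw [hEderiv.deriv] at hbound
  have hw0 : Complex.exp w ≠ 0 := Complex.exp_ne_zero w
  have hwn : 0 < ‖Complex.exp w‖ := norm_pos_iff.mpr hw0
  have e : (Complex.exp w)⁻¹ * _root_.deriv G w
      - ∑ n ∈ Finset.range N, (n + 1) * a (n + 1) * Complex.exp w ^ n
      = (Complex.exp w)⁻¹ * (_root_.deriv G w -
      ∑ n ∈ Finset.range (N + 1), a n * (n * Complex.exp w ^ n)) := by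
    rw [Finset.sum_range_succ', mul_sub, mul_add, Finset.mul_sum]
    simp only [Nat.cast_zero, zero_mul, mul_zero, add_zero]
    congr 1
    refine Finset.sum_congr rfl fun n _ => ?_
    push_cast
    field_simp
    ring
  rw [e, norm_mul, norm_inv]
  calc ‖Complex.exp w‖⁻¹ * _ ≤ ‖Complex.exp w‖⁻¹ *
        (C * (‖Complex.exp w‖ * Real.exp δ) ^ (N + 1) / δ) :=
        mul_le_mul_of_nonneg_left hbound (by positivity)
    _ = _ := by rw [mul_pow]; field_simp; ring

namespace LogSurface

theorem log_ofLog (w : ℂ) : log (ofLog w) = w := logEquiv.right_inv w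

theorem ofLog_log (p : LogSurface) : ofLog (log p) = p := logEquiv.left_inv p

theorem exp_log (p : LogSurface) : Complex.exp p.log = p.val := congrArg val (ofLog_log p)

theorem im_log (p : LogSurface) : p.log.im = p.arg := by simp [log]

theorem sderiv_ofLog (f : LogSurface → ℂ) (w : ℂ) :
    sderiv f (ofLog w) = (Complex.exp w)⁻¹ * deriv (fun w => f (ofLog w)) w := by
  rw [sderiv, log_ofLog]; rfl

theorem iterSderiv_succ_ofLog (n : ℕ) (f : LogSurface → ℂ) (w : ℂ) :
    iterSderiv (n + 1) f (ofLog w) =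
      (Complex.exp w)⁻¹ * deriv (fun w => iterSderiv n f (ofLog w)) w := by
  rw [iterSderiv, Function.iterate_succ_apply', sderiv_ofLog]; rfl

theorem hasStripExpansion_iterSderiv {a : ℕ → ℂ} {r : ℝ} {f : LogSurface → ℂ}
    (h : HasStripExpansion a r (fun w => f (ofLog w))) (n : ℕ) {r' : ℝ} (hr : r' < r) :
    HasStripExpansion (fun j => ((j + n).factorial / j.factorial : ℂ) * a (j + n)) r'
      (fun w => iterSderiv n f (ofLog w)) := by
  induction n generalizing r' with
  | zero =>
    have e : (fun j : ℕ => ((j + 0).factorial / j.factorial : ℂ) * a (j + 0)) = a := by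
      funext j
      rw [add_zero, div_self (Nat.cast_ne_zero.mpr j.factorial_ne_zero), one_mul]
    rw [e]
    have hmono : ∀ w : ℂ, |w.im| < r' → |w.im| < r := fun w hw => hw.trans hr
    refine ⟨h.1.mono hmono, fun N => ?_⟩
    obtain ⟨C, hC⟩ := h.2 N
    exact ⟨C, fun w hw => hC w (hmono w hw)⟩
  | succ n ih =>
    have := (ih (r' := (r + r') / 2) (by linarith)).deriv (r' := r') (by linarith)
    have e : (fun j : ℕ => ((j + (n + 1)).factorial / j.factorial : ℂ) * a (j + (n + 1)))
        = fun j : ℕ => ((j : ℂ) + 1) *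
          (((j + 1 + n).factorial / (j + 1).factorial : ℂ) * a (j + 1 + n)) := by
      funext j
      rw [show j + (n + 1) = j + 1 + n by ring, Nat.factorial_succ j]
      have := Nat.cast_ne_zero (R := ℂ) |>.mpr j.factorial_ne_zero
      have := Nat.cast_add_one_ne_zero (R := ℂ) j
      push_cast
      field_simp
    rw [e]
    simp only [iterSderiv_succ_ofLog]
    exact this

/-- Along the ray `t ↦ t p` the derivatives extend continuously to `t = 0`, with the values
`n! a n` prescribed by the expansion, so Taylor's formula holds up to the origin. -/
theorem taylor_of_hasStripExpansion {a : ℕ → ℂ} {r : ℝ} {f : LogSurface → ℂ}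
    (h : HasStripExpansion a r (fun w => f (ofLog w))) {p : LogSurface} (hp : |p.arg| < r) (N : ℕ) :
    IntervalIntegrable (remainderIntegrand N f p) volume 0 1 ∧
      f p = (∑ n ∈ Finset.range (N + 1), a n * p.val ^ n) + taylorRemainder (N + 1) f p := by
  obtain ⟨r', hpr, hr⟩ := exists_between hp
  -- at `t = 0` the value of `scale t p` is meaningless and is replaced by the limit
  set H : ℕ → ℝ → ℂ := fun n => Function.update (fun t => iterSderiv n f (scale t p)) 0
    (n.factorial * a n) with hH
  have hH0 : ∀ n, H n 0 = n.factorial * a n := fun n => by simp [hH]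
  have hHt : ∀ n, ∀ t : ℝ, 0 < t → H n t = iterSderiv n f (scale t p) := fun n t ht => by
    simp [hH, Function.update_of_ne ht.ne']
  have him : ∀ t : ℝ, |((Real.log t : ℂ) + p.log).im| < r' := fun t => by
    simpa [im_log] using hpr
  have hexp : ∀ t : ℝ, 0 < t → Complex.exp ((Real.log t : ℂ) + p.log) = t * p.val := fun t ht => by
    rw [Complex.exp_add, exp_log, ← Complex.ofReal_exp, Real.exp_log ht]
  have hd : ∀ n, ∀ t : ℝ, 0 < t → HasDerivAt (H n) (p.val * H (n + 1) t) t := by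
    intro n t ht
    have h1 := ((hasStripExpansion_iterSderiv h n hr).1.differentiableAt
      ((isOpen_strip r').mem_nhds (him t))).hasDerivAt
    have h2 : HasDerivAt (fun t : ℝ => (Real.log t : ℂ) + p.log) ((t⁻¹ : ℝ) : ℂ) t :=
      (Real.hasDerivAt_log ht.ne').ofReal_comp.add_const _
    have h3 := HasDerivAt.comp t h1 h2
    have e : H n =ᶠ[𝓝 t] (fun w => iterSderiv n f (ofLog w)) ∘
        fun t : ℝ => (Real.log t : ℂ) + p.log := by
      filter_upwards [lt_mem_nhds ht] with s hs
      exact hHt n s hs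
    refine (h3.congr_of_eventuallyEq e).congr_deriv ?_
    rw [hHt _ t ht, scale, iterSderiv_succ_ofLog, hexp t ht]
    have := p.val_ne_zero
    have : (t : ℂ) ≠ 0 := by exact_mod_cast ht.ne'
    push_cast
    field_simp
  have hc : ∀ n, ContinuousOn (H n) (Icc 0 1) := by
    intro n t ht
    rcases ht.1.eq_or_lt with rfl | h0
    · refine ((continuousWithinAt_Ioi_iff_Ici (a := (0 : ℝ))).mp ?_).mono Icc_subset_Ici_self
      rw [ContinuousWithinAt, hH0]
      obtain ⟨C, hC⟩ := (hasStripExpansion_iterSderiv h n hr).2 1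
      rw [tendsto_iff_norm_sub_tendsto_zero]
      refine squeeze_zero' (g := fun t : ℝ => C * (t * ‖p.val‖))
        (Eventually.of_forall fun _ => norm_nonneg _) ?_ ?_
      · filter_upwards [self_mem_nhdsWithin] with t ht
        have := hC _ (him t)
        rw [hexp t ht, norm_mul, Complex.norm_real, Real.norm_of_nonneg (le_of_lt ht)] at this
        rw [hHt n t ht, scale]
        simpa using this
      · have : Tendsto (fun t : ℝ => C * (t * ‖p.val‖)) (𝓝 0) (𝓝 (C * (0 * ‖p.val‖))) :=
          (tendsto_id.mul_const _).const_mul _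
        simp only [zero_mul, mul_zero] at this
        exact this.mono_left nhdsWithin_le_nhds
    · exact (hd n t h0).continuousAt.continuousWithinAt
  have hae : ∀ t ∈ Ioc (0 : ℝ) 1, (((1 - t) ^ N / (N.factorial : ℝ) : ℝ) : ℂ) * H (N + 1) t
      = remainderIntegrand N f p t := fun t ht => by
    rw [remainderIntegrand, hHt _ t ht.1]
  refine ⟨(intervalIntegrable_taylor_kernel (hc (N + 1)) N).congr ?_, ?_⟩
  · intro t ht
    rw [uIoc_of_le zero_le_one] at ht
    exact hae t ht
  · have key := taylor_integral_of_hasDerivAt hc (fun n t ht => hd n t ht.1) N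
    have h1 : H 0 1 = f p := by
      rw [hHt 0 1 one_pos, scale, Real.log_one, Complex.ofReal_zero, zero_add, ofLog_log]
      rfl
    rw [h1] at key
    rw [key, taylorRemainder]
    congr 1
    · refine Finset.sum_congr rfl fun n _ => ?_
      rw [hH0, mul_div_cancel_left₀ _ (Nat.cast_ne_zero.mpr n.factorial_ne_zero)]
    · congr 1
      refine intervalIntegral.integral_congr_ae (Eventually.of_forall fun t ht => ?_)
      rw [uIoc_of_le zero_le_one] at ht
      exact hae t ht

end LogSurface

theorem nevanlinnaSokal_of_strip {m : ℕ} {a : ℕ → ℂ} {f : LogSurface → ℂ} {A B : ℝ} (ρ : ℝ)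
    (hd : DifferentiableOn ℂ (fun w => f (LogSurface.ofLog w)) {w | |w.im| < m * Real.pi / 2})
    (hb : ∀ N : ℕ, ∀ w : ℂ, |w.im| < m * Real.pi / 2 →
      ‖f (LogSurface.ofLog w) - ∑ n ∈ Finset.range N, a n * Complex.exp w ^ n‖ ≤
        A * B ^ N * ((m * N).factorial : ℝ) * ‖Complex.exp w‖ ^ N) :
    NevanlinnaSokal m a f ρ A B := by
  have hs : HasStripExpansion a (m * Real.pi / 2) (fun w => f (LogSurface.ofLog w)) :=
    ⟨hd, fun N => ⟨_, hb N⟩⟩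
  have hexp : ∀ N : ℕ, ∀ p ∈ LogSurface.domain m ρ,
      f p = (∑ n ∈ Finset.range N, a n * p.val ^ n) + LogSurface.taylorRemainder N f p := by
    intro N p hp
    cases N with
    | zero => simp [LogSurface.taylorRemainder]
    | succ N => exact (LogSurface.taylor_of_hasStripExpansion hs hp.1 N).2
  refine ⟨?_, fun N p hp => (LogSurface.taylor_of_hasStripExpansion hs hp.1 N).1, hexp,
    fun N p hp => ?_⟩
  · refine (hd.analyticOnNhd (isOpen_strip _)).mono ?_
    rintro _ ⟨p, hp, rfl⟩
    show |p.log.im| < _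
    rw [LogSurface.im_log]
    exact hp.1
  · have := hb N p.log (by rw [LogSurface.im_log]; exact hp.1)
    rw [LogSurface.ofLog_log, LogSurface.exp_log, hexp N p hp, add_sub_cancel_left] at this
    exact this

/-! ### The Borel sum of a Stieltjes function -/

/-- The Borel-Leroy sum of order `m` attached to the Stieltjes transform of `ν`: the Laplace integral
along the ray `z = λ ^ (-1/m)`, on which the argument `λ z ^ m s ^ m` of the transform is real. -/
noncomputable def borelSum (m : ℕ) (ν : Measure ℝ) (p : LogSurface) : ℂ :=
  rayLaplace m (stieltjesTail ν 0) p.log (-p.log / m)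

theorem borelSum_ofLog (m : ℕ) (ν : Measure ℝ) (w : ℂ) :
    borelSum m ν (LogSurface.ofLog w) = rayLaplace m (stieltjesTail ν 0) w (-w / m) := by
  rw [borelSum, LogSurface.log_ofLog]

section
variable {m : ℕ} {ν : Measure ℝ} [IsProbabilityMeasure ν] {M : ℝ}

theorem norm_stieltjesTail_zero_le (hν : ∀ᵐ τ ∂ν, 0 < τ ∧ τ ≤ M) (u : ℂ) (hu : 0 < u.re) :
    ‖stieltjesTail ν 0 u‖ ≤ 1 := by
  simpa using norm_stieltjesTail_le hν 0 hu

theorem abs_im_neg_div_lt (hm : 1 ≤ m) {w : ℂ} (hw : |w.im| < m * Real.pi / 2) :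
    |(-w / m).im| < Real.pi / 2 := by
  have hm0 : (0 : ℝ) < m := by exact_mod_cast hm
  rw [Complex.div_natCast_im, Complex.neg_im, abs_div, abs_neg, Nat.abs_cast, div_lt_iff₀ hm0]
  linarith

theorem add_mul_neg_div (hm : 1 ≤ m) (w : ℂ) : w + m * (-w / m) = 0 := by
  have : (m : ℂ) ≠ 0 := Nat.cast_ne_zero.mpr (by omega)
  field_simp
  ring

theorem borelSum_ofLog_eq_rayLaplace (hm : 1 ≤ m) (hν : ∀ᵐ τ ∂ν, 0 < τ ∧ τ ≤ M) {w ζ : ℂ}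
    (hw : |w.im| < m * Real.pi / 2) (hζ : |ζ.im| < Real.pi / 2)
    (hwζ : |w.im + m * ζ.im| < Real.pi / 2) :
    borelSum m ν (LogSurface.ofLog w) = rayLaplace m (stieltjesTail ν 0) w ζ := by
  rw [borelSum_ofLog]
  refine rayLaplace_congr_ray (differentiableOn_stieltjesTail hν 0)
    (norm_stieltjesTail_zero_le hν) (abs_im_neg_div_lt hm hw) ?_ hζ hwζ
  have := congrArg Complex.im (add_mul_neg_div hm w)
  rw [Complex.add_im, ← Complex.ofReal_natCast, Complex.im_ofReal_mul, Complex.zero_im] at this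
  rw [← Complex.ofReal_natCast, this, abs_zero]
  positivity

theorem differentiableOn_borelSum (hm : 1 ≤ m) (hν : ∀ᵐ τ ∂ν, 0 < τ ∧ τ ≤ M) :
    DifferentiableOn ℂ (fun w => borelSum m ν (LogSurface.ofLog w))
      {w | |w.im| < m * Real.pi / 2} := by
  intro w hw
  simp only [borelSum_ofLog]
  refine (differentiableAt_rayLaplace (w := fun w => w) (ζ := fun w => -w / m)
    (differentiableOn_stieltjesTail hν 0) (norm_stieltjesTail_zero_le hν) (by fun_prop)
    (by fun_prop) (exp_re_pos_of_abs_im_lt (abs_im_neg_div_lt hm hw)) ?_).differentiableWithinAt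
  rw [add_mul_neg_div hm, Complex.exp_zero]
  exact one_pos

theorem rayLaplace_stieltjesTail_eq_sum_add (hν : ∀ᵐ τ ∂ν, 0 < τ ∧ τ ≤ M) (N : ℕ) {w ζ : ℂ}
    (hz : 0 < (Complex.exp ζ).re) (hP : 0 < (Complex.exp (w + m * ζ)).re) :
    rayLaplace m (stieltjesTail ν 0) w ζ =
      (∑ n ∈ Finset.range N, ((m * n).factorial * ∫ τ, (-(τ : ℂ)) ^ n ∂ν) * Complex.exp w ^ n)
        + rayLaplace m (fun u => u ^ N * stieltjesTail ν N u) w ζ := by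
  have hmono : ∀ n, IntegrableOn (fun s : ℝ => Complex.exp ζ *
      Complex.exp (-(Complex.exp ζ * s)) *
        (Complex.exp (w + m * ζ) * (s : ℂ) ^ m) ^ n) (Ioi 0) := fun n => by
    simpa using integrableOn_ray (m := m) (N := n) (Ψ := fun _ => 1) (C := 1)
      continuousOn_const (by simp) hz hP
  have htail := integrableOn_ray (m := m) (N := N) (differentiableOn_stieltjesTail hν N).continuousOn
    (fun u hu => norm_stieltjesTail_le hν N hu) hz hP
  have hterm : ∀ n, ((m * n).factorial * ∫ τ, (-(τ : ℂ)) ^ n ∂ν) * Complex.exp w ^ n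
      = ∫ s in Ioi (0 : ℝ), (∫ τ, (-(τ : ℂ)) ^ n ∂ν) * (Complex.exp ζ *
        Complex.exp (-(Complex.exp ζ * s)) *
        (Complex.exp (w + m * ζ) * (s : ℂ) ^ m) ^ n) := fun n => by
    have := rayLaplace_pow m n w ζ hz
    rw [rayLaplace] at this
    rw [integral_const_mul, this]
    ring
  simp only [hterm]
  rw [← integral_finsetSum _ fun n _ => (hmono n).const_mul _]
  simp only [rayLaplace]
  rw [← integral_add (integrable_finsetSum _ fun n _ => (hmono n).const_mul _) htail]
  refine setIntegral_congr_fun measurableSet_Ioi fun s hs => ?_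
  rw [stieltjesTail_eq_sum_add hν N one_pos fun τ h _ =>
    one_le_norm_one_add (mul_pow_re_pos hP m hs) h, mul_add, Finset.mul_sum]
  congr 1
  exact Finset.sum_congr rfl fun n _ => by ring

/-- Remainder bounds uniform in `arg λ`. On the ray `z = exp (i ψ)`, with
`ψ = -(1 - 1/(2m)) arg λ / m`, the argument of `λ z ^ m` is `arg λ / (2m)`, less than `π / 4` in absolute
value, while `|ψ|` stays below `π / 2 - π / (4m)`, so that `Re z ≥ κ`. -/
theorem norm_borelSum_sub_le (hm : 1 ≤ m) (hν : ∀ᵐ τ ∂ν, 0 < τ ∧ τ ≤ M) (N : ℕ) {w : ℂ}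
    (hw : |w.im| < m * Real.pi / 2) {κ : ℝ} (hκ : κ = Real.cos (Real.pi / 2 - Real.pi / (4 * m))) :
    ‖borelSum m ν (LogSurface.ofLog w) -
      ∑ n ∈ Finset.range N, ((m * n).factorial * ∫ τ, (-(τ : ℂ)) ^ n ∂ν) * Complex.exp w ^ n‖ ≤
      M ^ N * ‖Complex.exp w‖ ^ N * ((m * N).factorial / κ ^ (m * N + 1)) := by
  have hm0 : (0 : ℝ) < m := by exact_mod_cast hm
  have hm1 : (1 : ℝ) ≤ m := by exact_mod_cast hm
  have hpi := Real.pi_pos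
  set ψ : ℝ := -((1 - 1 / (2 * m)) * (w.im / m)) with hψ
  have hc : 0 ≤ 1 - 1 / (2 * (m : ℝ)) := by
    rw [sub_nonneg, div_le_one (by positivity)]; linarith
  have hψle : |ψ| ≤ Real.pi / 2 - Real.pi / (4 * m) := by
    rw [hψ, abs_neg, abs_mul, abs_of_nonneg hc, abs_div, Nat.abs_cast]
    have : |w.im| / m ≤ Real.pi / 2 := by rw [div_le_iff₀ hm0]; linarith
    calc _ ≤ (1 - 1 / (2 * (m : ℝ))) * (Real.pi / 2) := mul_le_mul_of_nonneg_left this hc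
      _ = _ := by field_simp; ring
  have hq : 0 < Real.pi / (4 * m) := by positivity
  have hψlt : |ψ| < Real.pi / 2 := by linarith
  have hsum : |w.im + m * ψ| < Real.pi / 2 := by
    have e : w.im + m * ψ = w.im / (2 * m) := by rw [hψ]; field_simp; ring
    rw [e, abs_div, abs_of_pos (by positivity : (0 : ℝ) < 2 * m), div_lt_iff₀ (by positivity)]
    have : 0 < m * Real.pi := by positivity
    linarith
  have hκ0 : 0 < κ := by
    rw [hκ]
    refine Real.cos_pos_of_mem_Ioo ⟨?_, by linarith⟩
    have : Real.pi / (4 * m) ≤ Real.pi / 4 :=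
      div_le_div_of_nonneg_left hpi.le (by norm_num) (by linarith)
    linarith
  set ζ : ℂ := (ψ : ℂ) * Complex.I with hζ
  have hζim : ζ.im = ψ := by simp [hζ]
  have hζre : ζ.re = 0 := by simp [hζ]
  have hz : 0 < (Complex.exp ζ).re := exp_re_pos_of_abs_im_lt (hζim ▸ hψlt)
  have hP : 0 < (Complex.exp (w + m * ζ)).re := exp_re_pos_of_abs_im_lt (by simpa [hζim] using hsum)
  have hzκ : κ ≤ (Complex.exp ζ).re := by
    rw [Complex.exp_re, hζre, hζim, Real.exp_zero, one_mul, hκ, ← Real.cos_abs ψ]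
    exact Real.cos_le_cos_of_nonneg_of_le_pi (abs_nonneg _) (by linarith) hψle
  rw [borelSum_ofLog_eq_rayLaplace hm hν hw (hζim ▸ hψlt) (hζim ▸ hsum),
    rayLaplace_stieltjesTail_eq_sum_add hν N hz hP, add_sub_cancel_left, rayLaplace]
  refine (norm_integral_ray_le (fun u hu => norm_stieltjesTail_le hν N hu) hz hP).trans ?_
  have n1 : ‖Complex.exp ζ‖ = 1 := by rw [Complex.norm_exp, hζre, Real.exp_zero]
  have n2 : ‖Complex.exp (w + m * ζ)‖ = ‖Complex.exp w‖ := by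
    rw [Complex.norm_exp, Complex.norm_exp]; simp [hζre]
  rw [n1, n2, mul_one]
  have hM : 0 ≤ M := by
    obtain ⟨τ, h⟩ := hν.exists
    exact h.1.le.trans h.2
  gcongr

/-- The substitution `u = s ^ m` turns the integrand of the inversion formula into that of the Laplace
integral defining `borelSum`. -/
theorem inversion_integrand_eq (hm : 1 ≤ m) (T : ℂ → ℂ) (p : LogSurface) {s : ℝ} (hs : 0 < s) :
    ((m : ℝ) * s ^ ((m : ℝ) - 1)) • (T (s ^ (m : ℝ) : ℝ) *
      Complex.exp (-LogSurface.divPow (s ^ (m : ℝ)) p (1 / (m : ℂ))) *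
        LogSurface.divPow (s ^ (m : ℝ)) p (1 / (m : ℂ) - 1)) =
    (m * p.val) * (Complex.exp (-p.log / m) * Complex.exp (-(Complex.exp (-p.log / m) * s)) *
      T (Complex.exp (p.log + m * (-p.log / m)) * (s : ℂ) ^ m)) := by
  have hm0 : (m : ℂ) ≠ 0 := Nat.cast_ne_zero.mpr (by omega)
  have hs0 : (s : ℂ) ≠ 0 := by exact_mod_cast hs.ne'
  have hlog : Complex.exp (Real.log s : ℂ) = s := by rw [← Complex.ofReal_exp, Real.exp_log hs]
  have e1 : LogSurface.divPow (s ^ (m : ℝ)) p (1 / (m : ℂ)) = Complex.exp (-p.log / m) * s := by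
    rw [LogSurface.divPow, Real.log_rpow hs, ← hlog, ← Complex.exp_add]
    congr 1
    push_cast
    field_simp
    ring
  have e2 : LogSurface.divPow (s ^ (m : ℝ)) p (1 / (m : ℂ) - 1)
      = Complex.exp (-p.log / m) * s * ((s : ℂ) ^ m)⁻¹ * p.val := by
    rw [LogSurface.divPow, Real.log_rpow hs, ← LogSurface.exp_log p, ← hlog, ← Complex.exp_nat_mul,
      ← Complex.exp_neg, ← Complex.exp_add, ← Complex.exp_add, ← Complex.exp_add]
    congr 1
    push_cast
    field_simp
    ring
  rw [e1, e2, add_mul_neg_div hm, Complex.exp_zero, one_mul, Real.rpow_sub_one hs.ne',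
    Real.rpow_natCast, Complex.real_smul]
  push_cast
  field_simp

theorem borelLeroySummable_borelSum (hm : 1 ≤ m) (hν : ∀ᵐ τ ∂ν, 0 < τ ∧ τ ≤ M) {a : ℕ → ℂ}
    (ha : ∀ n, a n = (m * n).factorial * ∫ τ, (-(τ : ℂ)) ^ n ∂ν) :
    BorelLeroySummable m a (borelSum m ν) := by
  have hM : 0 < M := by
    obtain ⟨τ, h⟩ := hν.exists
    exact h.1.trans_le h.2
  have hm0 : (0 : ℝ) < m := by exact_mod_cast hm
  have hm1 : (1 : ℝ) ≤ m := by exact_mod_cast hm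
  have hpi := Real.pi_pos
  obtain ⟨κ, hκ⟩ : ∃ κ, κ = Real.cos (Real.pi / 2 - Real.pi / (4 * m)) := ⟨_, rfl⟩
  have hκ0 : 0 < κ := by
    rw [hκ]
    have : Real.pi / (4 * m) ≤ Real.pi / 4 :=
      div_le_div_of_nonneg_left hpi.le (by norm_num) (by linarith)
    have hq : 0 < Real.pi / (4 * m) := by positivity
    exact Real.cos_pos_of_mem_Ioo ⟨by linarith, by linarith⟩
  have hκ1 : κ ≤ 1 := hκ ▸ Real.cos_le_one _
  set B := 2 * M / κ ^ m with hB
  have hB0 : 0 < B := by positivity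
  have hBM : B⁻¹ ≤ (2 * M)⁻¹ := by
    refine inv_anti₀ (by positivity) ?_
    rw [hB, le_div_iff₀ (by positivity)]
    exact mul_le_of_le_one_right (by positivity) (pow_le_one₀ hκ0.le hκ1)
  have hcore : ∀ p : LogSurface, borelSum m ν p =
      1 / ((m : ℂ) * p.val) * ∫ u in Ioi (0 : ℝ), stieltjesTail ν 0 u *
        Complex.exp (-LogSurface.divPow u p (1 / (m : ℂ))) *
          LogSurface.divPow u p (1 / (m : ℂ) - 1) := by
    intro p
    rw [← integral_comp_rpow_Ioi_of_pos hm0,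
      setIntegral_congr_fun measurableSet_Ioi fun s hs => inversion_integrand_eq hm _ p hs,
      integral_const_mul, ← mul_assoc, one_div_mul_cancel, one_mul]
    · rfl
    · exact mul_ne_zero (Nat.cast_ne_zero.mpr (by omega)) p.val_ne_zero
  refine ⟨1, κ⁻¹, B, one_pos, inv_pos.mpr hκ0, hB0, ?_, stieltjesTail ν 0, 1, 1, one_pos, ?_⟩
  · refine nevanlinnaSokal_of_strip 1 (differentiableOn_borelSum hm hν) fun N w hw => ?_
    simp only [ha]
    refine (norm_borelSum_sub_le hm hν N hw hκ).trans ?_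
    have h2 : M ^ N ≤ (2 * M) ^ N := pow_le_pow_left₀ hM.le (by linarith) N
    calc M ^ N * ‖Complex.exp w‖ ^ N * ((m * N).factorial / κ ^ (m * N + 1))
        ≤ (2 * M) ^ N * ‖Complex.exp w‖ ^ N * ((m * N).factorial / κ ^ (m * N + 1)) := by gcongr
      _ = _ := by
        rw [hB, div_pow, ← pow_mul, pow_succ]
        field_simp
  · refine ⟨fun u hu => ?_, ?_, fun u _ hu => ?_, fun p hp => ?_, fun p _ => hcore p⟩
    · refine (hasSum_stieltjesTail hν (hu.trans_le hBM)).congr_fun ?_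
      intro n
      rw [ha, mul_div_cancel_left₀ _ (Nat.cast_ne_zero.mpr (Nat.factorial_ne_zero _))]
    · have h1 : AnalyticOnNhd ℂ (stieltjesTail ν 0) (Metric.ball 0 B⁻¹) :=
        (differentiableOn_stieltjesTail_of_le hν 0 Metric.isOpen_ball one_half_pos
          fun u hu τ h0 h => half_le_norm_one_add
            ((by simpa using hu : ‖u‖ < B⁻¹).trans_le hBM) h0 h).analyticOnNhd Metric.isOpen_ball
      have h2 : AnalyticOnNhd ℂ (stieltjesTail ν 0) {u | 0 < u.re} :=
        (differentiableOn_stieltjesTail hν 0).analyticOnNhd isOpen_re_pos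
      rintro u (hu | hu)
      · exact h1 u hu
      · exact h2 u hu.2
    · refine (norm_stieltjesTail_zero_le hν u hu).trans ?_
      rw [one_mul, div_one]
      exact Real.one_le_exp (by positivity)
    · refine (integrableOn_Ioi_comp_rpow_iff _ hm0.ne').mp ?_
      rw [abs_of_pos hm0]
      refine IntegrableOn.congr_fun ?_
        (fun s hs => (inversion_integrand_eq hm (stieltjesTail ν 0) p hs).symm) measurableSet_Ioi
      refine Integrable.const_mul ?_ _
      have hz : 0 < (Complex.exp (-p.log / m)).re :=
        exp_re_pos_of_abs_im_lt (abs_im_neg_div_lt hm (by rw [LogSurface.im_log]; exact hp.1))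
      simpa [IntegrableOn] using integrableOn_ray (m := m) (N := 0)
        (differentiableOn_stieltjesTail hν 0).continuousOn (norm_stieltjesTail_zero_le hν) hz
        (P := Complex.exp (p.log + m * (-p.log / m)))
        (by rw [add_mul_neg_div hm, Complex.exp_zero]; exact one_pos)

/-- By the identity theorem the equality with `Z` need only be known for positive real arguments,
where it is read off from the Laplace integral along `z = 1`. -/
theorem extendsHalfPlane_borelSum (hm : 1 ≤ m) (hν : ∀ᵐ τ ∂ν, 0 < τ ∧ τ ≤ M) {Z : ℂ → ℂ}
    (hZ : DifferentiableOn ℂ Z {z | 0 < z.re})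
    (hZr : ∀ x : ℝ, 0 < x → Z x = ∫ s in Ioi (0 : ℝ),
      Complex.exp (-s) * stieltjesTail ν 0 (x * (s : ℂ) ^ m)) :
    ExtendsHalfPlane Z (borelSum m ν) := by
  have hm1 : (1 : ℝ) ≤ m := by exact_mod_cast hm
  have hpi := Real.pi_pos
  have hle : ∀ w : ℂ, |w.im| < Real.pi / 2 → |w.im| < m * Real.pi / 2 := fun w hw => by
    have : Real.pi ≤ m * Real.pi := le_mul_of_one_le_left hpi.le hm1
    linarith
  have h1 : AnalyticOnNhd ℂ (fun w => borelSum m ν (LogSurface.ofLog w))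
      {w | |w.im| < Real.pi / 2} :=
    ((differentiableOn_borelSum hm hν).analyticOnNhd (isOpen_strip _)).mono hle
  have h2 : AnalyticOnNhd ℂ (fun w => Z (Complex.exp w)) {w | |w.im| < Real.pi / 2} := by
    refine DifferentiableOn.analyticOnNhd ?_ (isOpen_strip _)
    exact hZ.comp (Differentiable.differentiableOn (by fun_prop))
      fun w hw => exp_re_pos_of_abs_im_lt hw
  have hconv : Convex ℝ {w : ℂ | |w.im| < Real.pi / 2} := by
    have : {w : ℂ | |w.im| < Real.pi / 2} = Complex.imLm ⁻¹' Ioo (-(Real.pi / 2)) (Real.pi / 2) := by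
      ext z; simp [abs_lt]
    rw [this]; exact (convex_Ioo _ _).linear_preimage _
  have hreal : ∀ x : ℝ, borelSum m ν (LogSurface.ofLog x) = Z (Complex.exp x) := fun x => by
    rw [borelSum_ofLog_eq_rayLaplace hm hν (ζ := 0) (hle _ (by simpa using hpi))
      (by simpa using hpi) (by simpa using hpi), ← Complex.ofReal_exp, hZr _ (Real.exp_pos x),
      rayLaplace]
    simp
  have hEq := h1.eqOn_of_preconnected_of_frequently_eq h2 hconv.isPreconnected
    (z₀ := 0) (by simpa using hpi)
    (frequently_nhdsNE_of_forall_ofReal (Eventually.of_forall hreal))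
  intro p hp
  have := hEq (show p.log ∈ {w : ℂ | |w.im| < Real.pi / 2} by
    show |p.log.im| < _
    rwa [LogSurface.im_log])
  simp only [LogSurface.ofLog_log, LogSurface.exp_log] at this
  exact this
end

/-! ### Laplace transforms of laws with Gamma-type moments -/

theorem integral_gammaMeasure_one (f : ℝ → ℂ) :
    ∫ s, f s ∂(gammaMeasure 1 1) = ∫ s in Ioi (0 : ℝ), Complex.exp (-s) * f s := by
  rw [gammaMeasure, integral_withDensity_eq_integral_toReal_smul (measurable_gammaPDF 1 1)
    (Eventually.of_forall fun x => ENNReal.ofReal_lt_top), ← integral_Ici_eq_integral_Ioi,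
    ← integral_indicator measurableSet_Ici]
  refine integral_congr_ae (Eventually.of_forall fun s => ?_)
  by_cases hs : 0 ≤ s
  · simp [gammaPDF, gammaPDFReal, indicator, hs, (Real.exp_pos _).le]
  · simp [gammaPDF, gammaPDFReal, indicator, hs]

theorem integral_gammaMeasure_one_exp {z : ℂ} (hz : 0 ≤ z.re) :
    ∫ s : ℝ, Complex.exp (-(z * s)) ∂(gammaMeasure 1 1) = 1 / (1 + z) := by
  rw [integral_gammaMeasure_one]
  have := integral_pow_mul_cexp_neg_mul 0 (z := 1 + z) (by simp; linarith)
  simp only [pow_zero, one_mul, Nat.factorial_zero, Nat.cast_one, zero_add, pow_one] at this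
  rw [← this]
  refine integral_congr_ae (Eventually.of_forall fun s => ?_)
  simp only
  rw [← Complex.exp_add]
  ring_nf

/-- Integrating `exp (-x p s ^ m τ)` over the exponential variable `p` gives `1 / (1 + x s ^ m τ)`, and
then over `τ` the Stieltjes transform of `ν` at `x s ^ m`. -/
theorem integral_exp_mulLaw_gammaMeasure {m : ℕ} {ν : Measure ℝ} [IsProbabilityMeasure ν]
    (hν : ∀ᵐ τ ∂ν, 0 < τ) {x : ℝ} (hx : 0 < x) :
    ∫ y : ℝ, Complex.exp (-(x * y)) ∂(mulLaw (gammaMeasure 1 1)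
      (mulLaw ((gammaMeasure 1 1).map fun x => x ^ (m : ℝ)) ν)) =
    ∫ s in Ioi (0 : ℝ), Complex.exp (-s) * stieltjesTail ν 0 (x * (s : ℂ) ^ m) := by
  have : IsProbabilityMeasure (gammaMeasure 1 1) :=
    isProbabilityMeasure_gammaMeasure one_pos one_pos
  have : IsProbabilityMeasure ((gammaMeasure 1 1).map fun x => x ^ (m : ℝ)) :=
    Measure.isProbabilityMeasure_map (by fun_prop)
  have h1 := ae_pos_gammaMeasure 1
  have h2 : ∀ᵐ x ∂((gammaMeasure 1 1).map fun x => x ^ (m : ℝ)), 0 < x := by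
    rw [ae_map_iff (by fun_prop) measurableSet_Ioi]
    filter_upwards [h1] with x hx using Real.rpow_pos_of_pos hx _
  have h3 := ae_mulLaw (r := fun x => 0 < x) h2 hν measurableSet_Ioi fun x y => mul_pos
  set κ := mulLaw ((gammaMeasure 1 1).map fun x => x ^ (m : ℝ)) ν with hκ
  have hpos : ∀ᵐ q ∂((gammaMeasure 1 1).prod κ), 0 < q.1 ∧ 0 < q.2 := by
    filter_upwards [Measure.quasiMeasurePreserving_fst.ae h1,
      Measure.quasiMeasurePreserving_snd.ae h3] with q a b using ⟨a, b⟩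
  have hpos' : ∀ᵐ q ∂(((gammaMeasure 1 1).map fun x => x ^ (m : ℝ)).prod ν), 0 < q.1 ∧ 0 < q.2 := by
    filter_upwards [Measure.quasiMeasurePreserving_fst.ae h2,
      Measure.quasiMeasurePreserving_snd.ae hν] with q a b using ⟨a, b⟩
  have i1 : Integrable (fun q : ℝ × ℝ => Complex.exp (-(x * (q.1 * q.2 : ℝ))))
      ((gammaMeasure 1 1).prod κ) := by
    refine (integrable_const (1 : ℝ)).mono' (by fun_prop) ?_
    filter_upwards [hpos] with q hq
    rw [← Complex.ofReal_mul, ← Complex.ofReal_neg, ← Complex.ofReal_exp, Complex.norm_real,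
      Real.norm_of_nonneg (Real.exp_pos _).le, Real.exp_le_one_iff, neg_nonpos]
    exact (mul_pos hx (mul_pos hq.1 hq.2)).le
  have i2 : Integrable (fun q : ℝ × ℝ => 1 / (1 + x * ((q.1 * q.2 : ℝ) : ℂ)))
      (((gammaMeasure 1 1).map fun x => x ^ (m : ℝ)).prod ν) := by
    refine (integrable_const (1 : ℝ)).mono' (Measurable.aestronglyMeasurable (by fun_prop)) ?_
    filter_upwards [hpos'] with q hq
    rw [norm_div, norm_one]
    exact div_le_one_of_le₀
      (one_le_norm_one_add (u := (x : ℂ)) (by simpa using hx) (mul_pos hq.1 hq.2)) (norm_nonneg _)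
  have e1 : ∀ᵐ y ∂κ, ∫ p : ℝ, Complex.exp (-(x * (p * y : ℝ))) ∂(gammaMeasure 1 1)
      = 1 / (1 + x * (y : ℂ)) := by
    filter_upwards [h3] with y hy
    rw [← integral_gammaMeasure_one_exp (z := x * y)
      (by rw [← Complex.ofReal_mul, Complex.ofReal_re]; exact (mul_pos hx hy).le)]
    refine integral_congr_ae (Eventually.of_forall fun p => ?_)
    push_cast; ring_nf
  rw [mulLaw, integral_map (by fun_prop) (by fun_prop), integral_prod_symm _ i1,
    integral_congr_ae e1, hκ, mulLaw, integral_map (by fun_prop)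
      (Measurable.aestronglyMeasurable (by fun_prop)), integral_prod _ i2, integral_map (by fun_prop),
    integral_gammaMeasure_one]
  · refine setIntegral_congr_fun measurableSet_Ioi fun s hs => ?_
    simp only [stieltjesTail, pow_zero]
    congr 1
    refine integral_congr_ae (Eventually.of_forall fun τ => ?_)
    simp only [Real.rpow_natCast]
    push_cast
    rw [mul_assoc]
  · exact i2.aestronglyMeasurable.integral_prod_right'

theorem exists_borelLeroySummable_of_powMoment {m : ℕ} (hm : 1 ≤ m) {α c : ℝ} (hα : 0 < α)
    (hα1 : α ≤ 1) (hc : 0 < c) {μ : Measure ℝ} [IsProbabilityMeasure μ] (hμ : ∀ᵐ x ∂μ, 0 < x)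
    (hμt : ∀ t, 0 < α + (m + 1) * t → powMoment μ t = ENNReal.ofReal
        (c ^ t * Real.Gamma (α + (m + 1) * t) / Real.Gamma α))
    {Z : ℂ → ℂ} (hZ : ∀ z : ℂ, 0 < z.re → Z z = ∫ x : ℝ, Complex.exp (-(z * x)) ∂μ)
    {a : ℕ → ℂ} (ha : ∀ n : ℕ, a n = (-1) ^ n / n.factorial *
      ((c ^ n * Real.Gamma (α + (m + 1) * n) / Real.Gamma α : ℝ) : ℂ)) :
    ∃ f : LogSurface → ℂ, ExtendsHalfPlane Z f ∧ BorelLeroySummable m a f := by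
  obtain ⟨ν, M, hνp, hM, hν, hνt⟩ := exists_stieltjesMeasure hm hα hα1 hc
  have hν0 : ∀ᵐ x ∂ν, 0 < x := hν.mono fun x hx => hx.1
  refine ⟨borelSum m ν, extendsHalfPlane_borelSum hm hν ?_ fun x hx => ?_,
    borelLeroySummable_borelSum hm hν fun n => ?_⟩
  · refine DifferentiableOn.congr (differentiableOn_integral_of_dominated isOpen_re_pos
      (F := fun z (x : ℝ) => Complex.exp (-(z * x))) (integrable_const (μ := μ) (1 : ℝ))
      (fun z _ => by fun_prop) (Eventually.of_forall fun x => ?_) ?_) fun z hz => hZ z hz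
    · exact Differentiable.differentiableOn (by fun_prop)
    · filter_upwards [hμ] with x hx z hz
      rw [norm_cexp_neg_mul_ofReal, Real.exp_le_one_iff, neg_nonpos]
      exact (mul_pos hz hx).le
  · rw [hZ _ (by simpa using hx), ← integral_exp_mulLaw_gammaMeasure hν0 hx,
      ← eq_mulLaw_gamma_of_powMoment hα hα1 hc hν0 hνt hμ hμt]
  · have hmn : 0 < α + (m + 1) * (n : ℝ) := by positivity
    have hG := Real.Gamma_pos_of_pos hmn
    have hGα := Real.Gamma_pos_of_pos hα
    have g1 : Real.Gamma (1 + n) = n.factorial := by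
      rw [add_comm]; exact Real.Gamma_nat_eq_factorial n
    have g2 : Real.Gamma (1 + m * n) = (m * n).factorial := by
      rw [add_comm]; exact_mod_cast Real.Gamma_nat_eq_factorial (m * n)
    have hI : ∫ τ : ℝ, (-(τ : ℂ)) ^ n ∂ν = (-1) ^ n * ((∫ τ : ℝ, τ ^ (n : ℝ) ∂ν : ℝ) : ℂ) := by
      rw [← integral_complex_ofReal, ← integral_const_mul]
      refine integral_congr_ae (Eventually.of_forall fun τ => ?_)
      simp only [Real.rpow_natCast]
      push_cast
      exact neg_pow _ _
    rw [hI, integral_rpow_of_powMoment hν0 (by rw [g1, g2]; positivity) (hνt n hmn), g1, g2, ha,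
      Real.rpow_natCast]
    have f1 : (n.factorial : ℂ) ≠ 0 := Nat.cast_ne_zero.mpr n.factorial_ne_zero
    have f2 : ((m * n).factorial : ℂ) ≠ 0 := Nat.cast_ne_zero.mpr (Nat.factorial_ne_zero _)
    have f3 : (Real.Gamma α : ℂ) ≠ 0 := by exact_mod_cast hGα.ne'
    push_cast
    field_simp

/-! ### The laws underlying the two partition functions -/

section
variable {X : Type*} [MeasurableSpace X] {V : Measure X} {d g : X → ℝ}

/-- Since `v` is positive, the integral is not the junk value `0`, so the integrand is integrable. -/
theorem powMoment_map_withDensity (hd : Measurable d) (hd0 : ∀ x, 0 ≤ d x) (hg : Measurable g)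
    (hg0 : ∀ x, 0 ≤ g x) {t v : ℝ} (hv : 0 < v) (h : ∫ x, g x ^ t * d x ∂V = v) :
    powMoment ((V.withDensity fun x => ENNReal.ofReal (d x)).map g) t = ENNReal.ofReal v := by
  have hint : Integrable (fun x => g x ^ t * d x) V := by
    by_contra hn
    rw [integral_undef hn] at h
    exact hv.ne h
  have hgt : Measurable fun x => ENNReal.ofReal (g x ^ t) := (measurable_ofReal_rpow t).comp hg
  rw [powMoment, lintegral_map (measurable_ofReal_rpow t) hg,
    lintegral_withDensity_eq_lintegral_mul _ hd.ennreal_ofReal hgt, ← h,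
    ofReal_integral_eq_lintegral_ofReal hint (Eventually.of_forall fun x =>
      mul_nonneg (Real.rpow_nonneg (hg0 x) t) (hd0 x))]
  refine lintegral_congr fun x => ?_
  rw [Pi.mul_apply, ← ENNReal.ofReal_mul (hd0 x), mul_comm]

theorem isProbabilityMeasure_of_powMoment_zero {μ : Measure ℝ} (h : powMoment μ 0 = 1) :
    IsProbabilityMeasure μ := ⟨by simpa [powMoment] using h⟩

theorem ae_pos_map_withDensity (hd : Measurable d) (hg : Measurable g)
    (hg0 : ∀ᵐ x ∂V, 0 < g x) :
    ∀ᵐ x ∂((V.withDensity fun x => ENNReal.ofReal (d x)).map g), 0 < x := by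
  rw [ae_map_iff hg.aemeasurable measurableSet_Ioi, ae_withDensity_iff hd.ennreal_ofReal]
  exact hg0.mono fun x hx _ => hx

theorem integral_map_withDensity (hd : Measurable d) (hd0 : ∀ x, 0 ≤ d x) (hg : Measurable g)
    {F : ℝ → ℂ} (hF : Measurable F) :
    ∫ y, F y ∂((V.withDensity fun x => ENNReal.ofReal (d x)).map g) = ∫ x, d x * F (g x) ∂V := by
  rw [integral_map hg.aemeasurable hF.aestronglyMeasurable,
    integral_withDensity_eq_integral_toReal_smul hd.ennreal_ofReal
      (Eventually.of_forall fun x => ENNReal.ofReal_lt_top)]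
  refine integral_congr_ae (Eventually.of_forall fun x => ?_)
  simp only [ENNReal.toReal_ofReal (hd0 x), Complex.real_smul]
end

theorem integral_rpow_mul_gaussianPDFReal {k : ℕ} {t : ℝ} (ht : 0 < 1 / 2 + k * t) :
    ∫ x : ℝ, (x ^ (2 * k) / 2) ^ t * gaussianPDFReal 0 1 x =
      (2 ^ ((k : ℝ) - 1)) ^ t * Real.Gamma (1 / 2 + k * t) / Real.Gamma (1 / 2) := by
  set q : ℝ := 2 * k * t with hq
  set F : ℝ → ℝ := fun y => ((2 : ℝ) ^ t)⁻¹ * (√(2 * Real.pi))⁻¹ *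
    (y ^ q * Real.exp (-(1 / 2) * y ^ (2 : ℝ))) with hF
  have e : ∀ x : ℝ, (x ^ (2 * k) / 2) ^ t * gaussianPDFReal 0 1 x = F |x| := by
    intro x
    have h1 : x ^ (2 * k) = |x| ^ (2 * k) := by rw [pow_mul, pow_mul, sq_abs]
    have h2 : (|x| ^ (2 * k)) ^ t = |x| ^ q := by
      rw [← Real.rpow_natCast, ← Real.rpow_mul (abs_nonneg x), hq]; push_cast; ring_nf
    simp only [hF, gaussianPDFReal, sub_zero, NNReal.coe_one, mul_one]
    rw [h1, Real.div_rpow (by positivity) two_pos.le, h2, Real.rpow_two, sq_abs]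
    ring_nf
  have hpow : (1 / 2 : ℝ) ^ (-(q + 1) / 2) = √2 * 2 ^ (k * t) := by
    rw [one_div, ← Real.rpow_neg_one, ← Real.rpow_mul two_pos.le, Real.sqrt_eq_rpow,
      ← Real.rpow_add two_pos, hq]
    ring_nf
  have hpow' : ((2 : ℝ) ^ ((k : ℝ) - 1)) ^ t = 2 ^ (k * t) / 2 ^ t := by
    rw [← Real.rpow_mul two_pos.le, sub_mul, one_mul, Real.rpow_sub two_pos]
  rw [integral_congr_ae (Eventually.of_forall e), integral_comp_abs (f := F), integral_const_mul,
    integral_rpow_mul_exp_neg_mul_rpow two_pos (by rw [hq]; linarith) one_half_pos,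
    Real.Gamma_one_half_eq, Real.sqrt_mul two_pos.le, hpow, hpow',
    show (q + 1) / 2 = 1 / 2 + k * t by rw [hq]; ring]
  have := Real.sqrt_pos.mpr Real.pi_pos
  have := Real.rpow_pos_of_pos two_pos t
  field_simp

theorem integral_rpow_mul_complexGaussian {k : ℕ} {t : ℝ} (ht : 0 < 1 + k * t) :
    ∫ φ : ℂ, (‖φ‖ ^ (2 * k)) ^ t * (Real.pi⁻¹ * Real.exp (-‖φ‖ ^ 2)) =
      Real.Gamma (1 + k * t) := by
  have := Complex.integral_rpow_mul_exp_neg_rpow (p := 2) (q := 2 * k * t) one_le_two (by linarith)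
  have e : ∀ φ : ℂ, (‖φ‖ ^ (2 * k)) ^ t * (Real.pi⁻¹ * Real.exp (-‖φ‖ ^ 2)) =
      Real.pi⁻¹ * (‖φ‖ ^ (2 * k * t) * Real.exp (-‖φ‖ ^ (2 : ℝ))) := by
    intro φ
    rw [← Real.rpow_natCast _ (2 * k), ← Real.rpow_mul (norm_nonneg φ), Real.rpow_two]
    push_cast; ring
  simp only [e]
  rw [integral_const_mul, this, show (2 * k * t + 2) / 2 = 1 + k * t by ring]
  have := Real.pi_ne_zero
  field_simp

theorem Gamma_half_add_nat (N : ℕ) : Real.Gamma (1 / 2 + N) =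
    (∏ j ∈ Finset.Icc 1 N, (2 * (j : ℝ) - 1)) / 2 ^ N * Real.Gamma (1 / 2) := by
  induction N with
  | zero => simp
  | succ N ih =>
    rw [Finset.prod_Icc_succ_top (by omega), show (1 / 2 + ((N + 1 : ℕ) : ℝ)) = 1 / 2 + N + 1 by
      push_cast; ring, Real.Gamma_add_one (by positivity), ih, pow_succ]
    push_cast
    ring

theorem exists_borelLeroySummable_partitionZ (k : ℕ) (hk : 2 ≤ k) :
    ∃ f : LogSurface → ℂ, ExtendsHalfPlane (partitionZ k) f ∧
      BorelLeroySummable (k - 1) (coeffZ k) f := by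
  obtain ⟨m, rfl⟩ : ∃ m, k = m + 1 := ⟨k - 1, by omega⟩
  rw [Nat.add_sub_cancel]
  set g : ℝ → ℝ := fun φ => φ ^ (2 * (m + 1)) / 2 with hg
  have hgm : Measurable g := by fun_prop
  have hg0 : ∀ x, 0 ≤ g x := fun x => div_nonneg (Even.pow_nonneg (even_two_mul _) x) two_pos.le
  have hgpos : ∀ᵐ x : ℝ, 0 < g x := by
    filter_upwards [Measure.ae_ne volume (0 : ℝ)] with x hx
    exact div_pos ((even_two_mul _).pow_pos hx) two_pos
  have hd := measurable_gaussianPDFReal 0 1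
  have hd0 := gaussianPDFReal_nonneg 0 1
  set μ : Measure ℝ := (volume.withDensity fun x => ENNReal.ofReal (gaussianPDFReal 0 1 x)).map g
    with hμ
  have hmom : ∀ t, 0 < (1 / 2 : ℝ) + (m + 1) * t → powMoment μ t = ENNReal.ofReal
      ((2 ^ (m : ℝ)) ^ t * Real.Gamma (1 / 2 + (m + 1) * t) / Real.Gamma (1 / 2)) := by
    intro t ht
    have := Real.Gamma_pos_of_pos ht
    refine powMoment_map_withDensity hd hd0 hgm hg0 (by positivity) ?_
    have := integral_rpow_mul_gaussianPDFReal (k := m + 1) (t := t) (by exact_mod_cast ht)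
    simpa using this
  have : IsProbabilityMeasure μ := isProbabilityMeasure_of_powMoment_zero (by
    rw [hmom 0 (by norm_num), mul_zero, add_zero, Real.rpow_zero, one_mul,
      div_self (Real.Gamma_pos_of_pos one_half_pos).ne', ENNReal.ofReal_one])
  refine exists_borelLeroySummable_of_powMoment (by omega) one_half_pos (by norm_num)
    (by positivity) (ae_pos_map_withDensity hd hgm hgpos) hmom (fun z _ => ?_) fun n => ?_
  · rw [integral_map_withDensity hd hd0 hgm (by fun_prop), partitionZ,
      integral_gaussianReal_eq_integral_smul one_ne_zero]
    refine integral_congr_ae (Eventually.of_forall fun φ => ?_)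
    simp only [Complex.real_smul, hg]
    push_cast
    ring_nf
  · rw [coeffZ, show (1 / 2 + ((m : ℝ) + 1) * n) = 1 / 2 + ((m + 1) * n : ℕ) by push_cast; ring,
      Gamma_half_add_nat, ← mul_assoc, mul_div_cancel_right₀ _
        (Real.Gamma_pos_of_pos one_half_pos).ne', Real.rpow_natCast, add_mul, pow_add, one_mul,
      ← pow_mul]
    have : (n.factorial : ℂ) ≠ 0 := Nat.cast_ne_zero.mpr n.factorial_ne_zero
    push_cast
    field_simp

theorem exists_borelLeroySummable_partitionZc (k : ℕ) (hk : 2 ≤ k) :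
    ∃ f : LogSurface → ℂ, ExtendsHalfPlane (partitionZc k) f ∧
      BorelLeroySummable (k - 1) (coeffZc k) f := by
  obtain ⟨m, rfl⟩ : ∃ m, k = m + 1 := ⟨k - 1, by omega⟩
  rw [Nat.add_sub_cancel]
  set g : ℂ → ℝ := fun φ => ‖φ‖ ^ (2 * (m + 1)) with hg
  set d : ℂ → ℝ := fun φ => Real.pi⁻¹ * Real.exp (-‖φ‖ ^ 2) with hd
  have hgm : Measurable g := by fun_prop
  have hg0 : ∀ x, 0 ≤ g x := fun x => by positivity
  have hgpos : ∀ᵐ x : ℂ, 0 < g x := by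
    filter_upwards [Measure.ae_ne volume (0 : ℂ)] with x hx
    exact pow_pos (norm_pos_iff.mpr hx) _
  have hdm : Measurable d := by fun_prop
  have hd0 : ∀ x, 0 ≤ d x := fun x => by positivity
  set μ : Measure ℝ := (volume.withDensity fun x => ENNReal.ofReal (d x)).map g with hμ
  have hmom : ∀ t, 0 < (1 : ℝ) + (m + 1) * t → powMoment μ t = ENNReal.ofReal
      (1 ^ t * Real.Gamma (1 + (m + 1) * t) / Real.Gamma 1) := by
    intro t ht
    have := Real.Gamma_pos_of_pos ht
    refine powMoment_map_withDensity hdm hd0 hgm hg0 (by positivity) ?_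
    have := integral_rpow_mul_complexGaussian (k := m + 1) (t := t) (by exact_mod_cast ht)
    simpa using this
  have : IsProbabilityMeasure μ := isProbabilityMeasure_of_powMoment_zero (by
    rw [hmom 0 (by norm_num)]
    simp)
  refine exists_borelLeroySummable_of_powMoment (by omega) one_pos le_rfl
    one_pos (ae_pos_map_withDensity hdm hgm hgpos) hmom (fun z _ => ?_) fun n => ?_
  · rw [integral_map_withDensity hdm hd0 hgm (by fun_prop), partitionZc]
    refine integral_congr_ae (Eventually.of_forall fun φ => ?_)
    simp only [hg, hd, Complex.conj_mul']
    push_cast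
    rw [← pow_mul]
    ring_nf
  · rw [coeffZc, show (1 + ((m : ℝ) + 1) * n) = ((m + 1) * n : ℕ) + 1 by push_cast; ring,
      Real.Gamma_nat_eq_factorial]
    simp
    ring

theorem theorem2 (k : ℕ) (hk : 2 ≤ k) :
    (∃ f : LogSurface → ℂ, ExtendsHalfPlane (partitionZ k) f ∧
      BorelLeroySummable (k - 1) (coeffZ k) f) ∧
    (∃ f : LogSurface → ℂ, ExtendsHalfPlane (partitionZc k) f ∧
      BorelLeroySummable (k - 1) (coeffZc k) f) :=
  ⟨exists_borelLeroySummable_partitionZ k hk, exists_borelLeroySummable_partitionZc k hk⟩
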